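/- **Setting.** Let $s\in\mathbb R^n$ be the tangent-configuration-space variable, let $\mathcal P=\{s\mid Cs\le d\}$ with $C\in\mathbb R^{m\times n}$ (rows $c_j^T$) and $d\in\mathbb R^m$, and let $\mathcal P_{lim}=\{s\mid s_l\le s\le s_u\}$. A *rational point* is $p(s)=f(s)/g(s)\in\mathbb R^3$ with $f$ a vector of polynomials and $g$ a polynomial that is positive on $\mathbb R^n$. A *rational frame* $G$ is a rotation $R(s)=N(s)/g(s)\in SO(3)$ together with an origin $p(s)=f(s)/g(s)$, with polynomial entries $N,f$ and a common denominator $g>0$ on $\mathbb R^n$. A *body* is one of: 1. a polytope: the convex hull of finitely many rational points $v_i(s)$; 2. a sphere: the closed ball with rational center $o(s)$ and radius $r\ge 0$; 3. a capsule: the convex hull of two such spheres, with centers $o_1,o_2$ and radii $r_1,r_2\ge 0$; 4. a cylinder: the convex hull of two circles given, in a rational frame $G$, as the circle of radius $r_1\ge0$ at height $h$ and the circle of radius $r_2\ge0$ at height $-h$ ($h\ge0$), centered on the $z$-axis and parallel to the $xy$-plane; 5. a rigid body whose shape, in a rational frame $G$, is a convex set $\{x\in\mathbb R^3\mid\gamma_i(x)\ge0\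 \forall i\}$ given by finitely many polynomials that are Archimedean: $N-\|x\|^2=\sigma_0+\sum_i\sigma_i\gamma_i$ for some $N\in\mathbb N$ and sums of squares $\sigma_i$. In particular a rigid polytope, sphere or capsule attached to a rational frame is covered. Let $(\mathcal A_i,\mathcal B_i)$ be a finite family of pairs of bodies (the collision pairs). **The program of degrees $(\kappa,\rho)$.** For each pair $(\mathcal A,\mathcal B)$ find polynomials $a(s)\in\mathbb R[s]^3$, $b(s)\in\mathbb R[s]$ of degree at most $\kappa$ such that $a(s)^Tx+b(s)>0$ for all $s\in\mathcal P$, $x\in\mathcal A(s)$, and $a(s)^Ty+b(s)<0$ for all $s\in\mathcal P$, $y\in\mathcal B(s)$, together with the certificates below for $\mathcal A$ with $(a,b)$ and for $\mathcal B$ with $(-a,-b)$. All multipliers have degree at most $\rho$; $\lambda_j$ and $\mu_i$ are sums of squares and $\phi$ is arbitrary. Write - (P$_{f,g}$): $\;a^Tf+(b-1)g=\lambda_0+\sum_{j=1}^m\lambda_j\,(d_j-c_j^Ts)$ in $\mathbb R[s]$; - (M$_{\gamma,w}$): $\;u^T\begin{bmatrix}\gamma I&w\\ w^T&\gamma\end{bmatrix}u=\lambda_0+\sum_{j=1}^m\lambda_j\,(d_j-c_j^Ts)+\phi\,(1-u^Tu)$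 in $\mathbb R[u,s]$. The certificates required are: - polytope: (P$_{f,g}$) for each vertex $f/g$; - sphere: (P$_{f,g}$) for the center $o=f/g$, and (M$_{\gamma,w}$) with $\gamma=a^Tf+bg$, $w=r\,g\,a$; - capsule: the sphere conditions for $(o_1,r_1)$ and for $(o_2,r_2)$; - cylinder in the frame $(N/g,f/g)$: with $\alpha=N^Ta$ and $\beta=a^Tf+bg$, (M$_{\gamma,w}$) for $\gamma=h\alpha_z+\beta$, $w=r_1(\alpha_x,\alpha_y)$ and for $\gamma=-h\alpha_z+\beta$, $w=r_2(\alpha_x,\alpha_y)$, and (P$_{f,g}$); - semialgebraic rigid body in the frame $(N/g,f/g)$: $\;a^T(Nx+f)+(b-1)g=\lambda_0+\sum_{j=1}^m\lambda_j\,(d_j-c_j^Ts)+\sum_i\mu_i\,\gamma_i(x)$ in $\mathbb R[x,s]$. **Theorem.** Suppose $\mathcal P\subseteq\mathcal P_{lim}$ and $\mathcal P$ is collision-free: $\mathcal A_i(s)\cap\mathcal B_i(s)=\emptyset$ for every $s\in\mathcal P$ and every pair $i$. Then there exist finite degrees $\kappa_0,\rho_0$ such that the program of degrees $(\kappa,\rho)$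 is feasible for all $\kappa\ge\kappa_0$ and $\rho\ge\rho_0$. -/

import Mathlib

noncomputable section

namespace HyperplaneCert

open MvPolynomial

/-- A point of task space moving as a rational function `num / den` of the
tangent-configuration-space variable `s ∈ ℝⁿ`, with an everywhere positive denominator. -/
structure RatPoint (n : ℕ) where
  num : Fin 3 → MvPolynomial (Fin n) ℝ
  den : MvPolynomial (Fin n) ℝ
  den_pos : ∀ s : Fin n → ℝ, 0 < eval s den

/-- The position of a rational point at the configuration `s`. -/
def RatPoint.pos {n : ℕ} (p : RatPoint n) (s : Fin n → ℝ) : EuclideanSpace ℝ (Fin 3) :=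
  WithLp.toLp 2 fun k => eval s (p.num k) / eval s p.den

/-- A frame whose pose (rotation matrix and origin) is a rational function of `s`, written over a
common, everywhere positive denominator. -/
structure RatPose (n : ℕ) where
  rotNum : Matrix (Fin 3) (Fin 3) (MvPolynomial (Fin n) ℝ)
  posNum : Fin 3 → MvPolynomial (Fin n) ℝ
  den : MvPolynomial (Fin n) ℝ
  den_pos : ∀ s : Fin n → ℝ, 0 < eval s den
  rot_mem : ∀ s : Fin n → ℝ,
    (Matrix.of fun i j => eval s (rotNum i j) / eval s den) ∈
      Matrix.specialOrthogonalGroup (Fin 3) ℝ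

/-- The point with constant coordinates `v` in the moving frame `X`, as a rational point. -/
def RatPose.point {n : ℕ} (X : RatPose n) (v : Fin 3 → ℝ) : RatPoint n where
  num k := ∑ l, X.rotNum k l * C (v l) + X.posNum k
  den := X.den
  den_pos := X.den_pos

/-- The basic closed semialgebraic set `{x | γᵢ(x) ≥ 0 for all i}` in task space. -/
def basicSet {m : ℕ} (γ : Fin m → MvPolynomial (Fin 3) ℝ) : Set (EuclideanSpace ℝ (Fin 3)) :=
  {x | ∀ i, 0 ≤ eval (fun k => x k) (γ i)}

/-- The Archimedean property of a finite system of polynomial inequalities `gᵢ ≥ 0`. -/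
def IsArchimedean {σ : Type*} [Fintype σ] {m : ℕ} (g : Fin m → MvPolynomial σ ℝ) : Prop :=
  ∃ (N : ℕ) (lam₀ : MvPolynomial σ ℝ) (lam : Fin m → MvPolynomial σ ℝ),
    IsSumSq lam₀ ∧ (∀ i, IsSumSq (lam i)) ∧
      (C (N : ℝ) - ∑ k, X k ^ 2 : MvPolynomial σ ℝ) = lam₀ + ∑ i, lam i * g i

/-- Convex collision bodies moving rationally with `s`. A rigid polytope, sphere or capsule in a
frame `X` of rational pose is obtained by taking the vertices or centers to be `X.point v`. -/
inductive Body (n : ℕ) where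
  /-- The convex hull of finitely many moving vertices. -/
  | polytope (m : ℕ) (v : Fin m → RatPoint n)
  /-- The solid sphere with moving center `o` and radius `r`. -/
  | sphere (o : RatPoint n) (r : ℝ) (hr : 0 ≤ r)
  /-- The convex hull of two solid spheres. -/
  | capsule (o₁ o₂ : RatPoint n) (r₁ r₂ : ℝ) (hr₁ : 0 ≤ r₁) (hr₂ : 0 ≤ r₂)
  /-- The convex hull of two circles, of radius `r₁` at height `h` and of radius `r₂` at height
  `-h`, both centered on the `z`-axis of the frame `G` and parallel to its `xy`-plane. -/
  | cylinder (G : RatPose n) (h r₁ r₂ : ℝ) (hh : 0 ≤ h) (hr₁ : 0 ≤ r₁) (hr₂ : 0 ≤ r₂)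
  /-- A rigid body that, in its frame `G`, is a convex basic semialgebraic set with an
  Archimedean description. -/
  | semialgebraic (G : RatPose n) (m : ℕ) (γ : Fin m → MvPolynomial (Fin 3) ℝ)
      (hconv : Convex ℝ (basicSet γ)) (harch : IsArchimedean γ)

/-- The subset of task space that the body occupies at the configuration `s`. -/
def Body.region {n : ℕ} (s : Fin n → ℝ) : Body n → Set (EuclideanSpace ℝ (Fin 3))
  | .polytope _ v => convexHull ℝ (Set.range fun i => (v i).pos s)
  | .sphere o r _ => Metric.closedBall (o.pos s) r
  | .capsule o₁ o₂ r₁ r₂ _ _ =>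
      convexHull ℝ (Metric.closedBall (o₁.pos s) r₁ ∪ Metric.closedBall (o₂.pos s) r₂)
  | .cylinder G h r₁ r₂ _ _ _ =>
      convexHull ℝ
        ((Set.range fun α : ℝ => (G.point ![r₁ * Real.cos α, r₁ * Real.sin α, h]).pos s) ∪
          Set.range fun α : ℝ => (G.point ![r₂ * Real.cos α, r₂ * Real.sin α, -h]).pos s)
  | .semialgebraic G _ γ _ _ => (fun x => (G.point fun k => x k).pos s) '' basicSet γ

/-- The polyhedron `{s | C s ≤ d}`. -/
def polyhedron {n m : ℕ} (Cm : Matrix (Fin m) (Fin n) ℝ) (d : Fin m → ℝ) : Set (Fin n → ℝ) :=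
  {s | Cm.mulVec s ≤ d}

/-- The joint-limit box `{s | s_l ≤ s ≤ s_u}`. -/
def jointLimitBox {n : ℕ} (sl su : Fin n → ℝ) : Set (Fin n → ℝ) := Set.Icc sl su

/-- The configurations at which no pair `(A i, B i)` of bodies is in collision. -/
def tcFree {n : ℕ} {ι : Type*} (A B : ι → Body n) : Set (Fin n → ℝ) :=
  {s | ∀ i, Disjoint ((A i).region s) ((B i).region s)}

/-- The affine polynomial `d_j - c_jᵀ s` of the `j`-th facet inequality. -/
def slack {n m : ℕ} (Cm : Matrix (Fin m) (Fin n) ℝ) (d : Fin m → ℝ) (j : Fin m) :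
    MvPolynomial (Fin n) ℝ :=
  C (d j) - ∑ i, C (Cm j i) * X i

/-- The polynomial `p(s)` equals `λ₀ + ∑ λ_j (d_j - c_jᵀ s)` with SOS multipliers in `ℝ[s]` of
degree at most `ρ`. -/
def ScalarCert {n m : ℕ} (Cm : Matrix (Fin m) (Fin n) ℝ) (d : Fin m → ℝ) (ρ : ℕ)
    (p : MvPolynomial (Fin n) ℝ) : Prop :=
  ∃ (lam₀ : MvPolynomial (Fin n) ℝ) (lam : Fin m → MvPolynomial (Fin n) ℝ),
    (IsSumSq lam₀ ∧ lam₀.totalDegree ≤ ρ) ∧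
    (∀ j, IsSumSq (lam j) ∧ (lam j).totalDegree ≤ ρ) ∧
    p = lam₀ + ∑ j, lam j * slack Cm d j

/-- The matrix `[[γ I, w], [wᵀ, γ]]`, positive semidefinite if and only if `γ ≥ ‖w‖`. -/
def schurMatrix {n k : ℕ} (γ : MvPolynomial (Fin n) ℝ) (w : Fin k → MvPolynomial (Fin n) ℝ) :
    Matrix (Fin k ⊕ Unit) (Fin k ⊕ Unit) (MvPolynomial (Fin n) ℝ) :=
  Matrix.fromBlocks (Matrix.diagonal fun _ => γ) (Matrix.of fun i _ => w i)
    (Matrix.of fun _ j => w j) (Matrix.of fun _ _ => γ)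

/-- The polynomial `uᵀ M(s) u` equals `λ₀ + ∑ λ_j (d_j - c_jᵀ s) + φ (1 - uᵀ u)` in `ℝ[u, s]`,
with SOS multipliers `λ₀`, `λ_j` and a free multiplier `φ`, all of degree at most `ρ`. -/
def MatrixCert {n m : ℕ} {τ : Type} [Fintype τ] (Cm : Matrix (Fin m) (Fin n) ℝ) (d : Fin m → ℝ)
    (ρ : ℕ) (M : Matrix τ τ (MvPolynomial (Fin n) ℝ)) : Prop :=
  ∃ (lam₀ : MvPolynomial (τ ⊕ Fin n) ℝ) (lam : Fin m → MvPolynomial (τ ⊕ Fin n) ℝ)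
    (φ : MvPolynomial (τ ⊕ Fin n) ℝ),
    (IsSumSq lam₀ ∧ lam₀.totalDegree ≤ ρ) ∧
    (∀ j, IsSumSq (lam j) ∧ (lam j).totalDegree ≤ ρ) ∧
    φ.totalDegree ≤ ρ ∧
    (∑ i, ∑ j, X (Sum.inl i) * rename Sum.inr (M i j) * X (Sum.inl j) :
        MvPolynomial (τ ⊕ Fin n) ℝ) =
      lam₀ + ∑ j, lam j * rename Sum.inr (slack Cm d j) + φ * (1 - ∑ i, X (Sum.inl i) ^ 2)

/-- The certificate for `s ∈ P → a(s)ᵀ p(s) + b(s) ≥ 1`, denominators cleared. -/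
def PointCert {n m : ℕ} (Cm : Matrix (Fin m) (Fin n) ℝ) (d : Fin m → ℝ) (ρ : ℕ)
    (a : Fin 3 → MvPolynomial (Fin n) ℝ) (b : MvPolynomial (Fin n) ℝ) (p : RatPoint n) : Prop :=
  ScalarCert Cm d ρ (∑ k, a k * p.num k + (b - 1) * p.den)

/-- The certificate for `s ∈ P → a(s)ᵀ o(s) + b(s) ≥ r ‖a(s)‖`, denominators cleared. -/
def RoundCert {n m : ℕ} (Cm : Matrix (Fin m) (Fin n) ℝ) (d : Fin m → ℝ) (ρ : ℕ)
    (a : Fin 3 → MvPolynomial (Fin n) ℝ) (b : MvPolynomial (Fin n) ℝ) (o : RatPoint n)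
    (r : ℝ) : Prop :=
  MatrixCert Cm d ρ
    (schurMatrix (∑ k, a k * o.num k + b * o.den) fun k => C r * a k * o.den)

/-- Numerators of `Rᵀ a`, the plane normal expressed in the frame `G`. -/
def normalNum {n : ℕ} (G : RatPose n) (a : Fin 3 → MvPolynomial (Fin n) ℝ) (l : Fin 3) :
    MvPolynomial (Fin n) ℝ :=
  ∑ k, G.rotNum k l * a k

/-- Numerator of `b + aᵀ p`, the plane offset expressed in the frame `G`. -/
def offsetNum {n : ℕ} (G : RatPose n) (a : Fin 3 → MvPolynomial (Fin n) ℝ)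
    (b : MvPolynomial (Fin n) ℝ) : MvPolynomial (Fin n) ℝ :=
  ∑ k, a k * G.posNum k + b * G.den

/-- The certificate that the circle of radius `r` at height `z` in the frame `G` lies on the
nonnegative side of the plane: with the plane `(ᴳa, ᴳb)` expressed in `G`,
`z ᴳa_z + ᴳb ≥ r ‖(ᴳa_x, ᴳa_y)‖`, denominators cleared. -/
def RimCert {n m : ℕ} (Cm : Matrix (Fin m) (Fin n) ℝ) (d : Fin m → ℝ) (ρ : ℕ)
    (a : Fin 3 → MvPolynomial (Fin n) ℝ) (b : MvPolynomial (Fin n) ℝ) (G : RatPose n)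
    (z r : ℝ) : Prop :=
  MatrixCert Cm d ρ
    (schurMatrix (C z * normalNum G a 2 + offsetNum G a b)
      ![C r * normalNum G a 0, C r * normalNum G a 1])

/-- The certificate, in `ℝ[x, s]`, for `s ∈ P, γᵢ(x) ≥ 0 → a(s)ᵀ (R(s) x + p(s)) + b(s) ≥ 1`,
denominators cleared. -/
def SemialgebraicCert {n m : ℕ} (Cm : Matrix (Fin m) (Fin n) ℝ) (d : Fin m → ℝ) (ρ : ℕ)
    (a : Fin 3 → MvPolynomial (Fin n) ℝ) (b : MvPolynomial (Fin n) ℝ) (G : RatPose n)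
    {l : ℕ} (γ : Fin l → MvPolynomial (Fin 3) ℝ) : Prop :=
  ∃ (lam₀ : MvPolynomial (Fin 3 ⊕ Fin n) ℝ) (lam : Fin m → MvPolynomial (Fin 3 ⊕ Fin n) ℝ)
    (mu : Fin l → MvPolynomial (Fin 3 ⊕ Fin n) ℝ),
    (IsSumSq lam₀ ∧ lam₀.totalDegree ≤ ρ) ∧
    (∀ j, IsSumSq (lam j) ∧ (lam j).totalDegree ≤ ρ) ∧
    (∀ i, IsSumSq (mu i) ∧ (mu i).totalDegree ≤ ρ) ∧
    (∑ k, rename Sum.inr (normalNum G a k) * X (Sum.inl k) +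
        rename Sum.inr (offsetNum G a (b - 1)) : MvPolynomial (Fin 3 ⊕ Fin n) ℝ) =
      lam₀ + ∑ j, lam j * rename Sum.inr (slack Cm d j) + ∑ i, mu i * rename Sum.inl (γ i)

/-- The Putinar conditions, with multipliers of degree at most `ρ`, which enforce that the body is
on the positive side of the plane `a(s)ᵀ x + b(s) = 0` for all `s` in the polyhedron. -/
def Body.SideCert {n m : ℕ} (Cm : Matrix (Fin m) (Fin n) ℝ) (d : Fin m → ℝ) (ρ : ℕ)
    (a : Fin 3 → MvPolynomial (Fin n) ℝ) (b : MvPolynomial (Fin n) ℝ) : Body n → Prop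
  | .polytope _ v => ∀ i, PointCert Cm d ρ a b (v i)
  | .sphere o r _ => RoundCert Cm d ρ a b o r ∧ PointCert Cm d ρ a b o
  | .capsule o₁ o₂ r₁ r₂ _ _ =>
      (RoundCert Cm d ρ a b o₁ r₁ ∧ PointCert Cm d ρ a b o₁) ∧
        RoundCert Cm d ρ a b o₂ r₂ ∧ PointCert Cm d ρ a b o₂
  | .cylinder G h r₁ r₂ _ _ _ =>
      RimCert Cm d ρ a b G h r₁ ∧ RimCert Cm d ρ a b G (-h) r₂ ∧
        ScalarCert Cm d ρ (offsetNum G a (b - 1))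
  | .semialgebraic G _ γ _ _ => SemialgebraicCert Cm d ρ a b G γ

/-- Feasibility of the parametrized-separating-hyperplane program with hyperplane polynomials of
degree at most `κ` and multipliers of degree at most `ρ`: for every pair there is a polynomial
family of hyperplanes that strictly separates the bodies over the whole polyhedron, together with
the Putinar certificates for both sides (the side of `B i` being the positive side of `(-a, -b)`). -/
def ProgramFeasible {n m : ℕ} {ι : Type*} (Cm : Matrix (Fin m) (Fin n) ℝ) (d : Fin m → ℝ)
    (A B : ι → Body n) (κ ρ : ℕ) : Prop :=
  ∀ i, ∃ (a : Fin 3 → MvPolynomial (Fin n) ℝ) (b : MvPolynomial (Fin n) ℝ),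
    ((∀ k, (a k).totalDegree ≤ κ) ∧ b.totalDegree ≤ κ) ∧
    (∀ s ∈ polyhedron Cm d,
      (∀ x ∈ (A i).region s, 0 < ∑ k, eval s (a k) * x k + eval s b) ∧
      (∀ y ∈ (B i).region s, ∑ k, eval s (a k) * y k + eval s b < 0)) ∧
    (A i).SideCert Cm d ρ a b ∧ (B i).SideCert Cm d ρ (-a) (-b)

end HyperplaneCert

end

/-! The polyhedron `P` is closed and lies in a box, so it is compact. Over it, each body is the
convex hull of a compact set that moves continuously with `s`. At a fixed `s`, Hahn–Banach strictly
separates the two compact hulls. The coefficient vectors that separate at `s` form a convex set, and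
each of them still separates at nearby `s`. A partition of unity therefore glues local choices into
a continuous family of planes, whose margin is uniform by compactness. Stone–Weierstrass replaces it
by a polynomial family, and rescaling raises the margin above 1 (`exists_polynomial_solution`,
`exists_separating_polynomials`).

With this family fixed, every polynomial to be certified is strictly positive on a basic closed
semialgebraic set, and `putinar` supplies the multipliers once the variables are bounded modulo the
quadratic module. For `s` this follows from Farkas' lemma and the box (`isBoundedMod_slack`), for
`u` from `uᵀu = 1`, and for `x` from the assumed Archimedean description. Finitely many identities
occur, so the largest degrees in them give `κ₀` and `ρ₀`.

Putinar's theorem is itself derived from an abstract Positivstellensatz: a maximal proper quadratic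
module containing an Archimedean one determines a real character, and characters of a polynomial
ring are point evaluations. -/

namespace HyperplaneCert

/-! ### Archimedean quadratic modules and the abstract Positivstellensatz -/

/-- A quadratic module of a commutative ring: a set containing `1` and closed under addition and
under multiplication by squares. -/
structure IsQuadraticModule {A : Type*} [CommRing A] (Q : Set A) : Prop where
  one_mem : (1 : A) ∈ Q
  add_mem : ∀ {p q : A}, p ∈ Q → q ∈ Q → p + q ∈ Q
  sq_mul_mem : ∀ (a : A) {q : A}, q ∈ Q → a ^ 2 * q ∈ Q

/-- An element bounded above and below by constants with respect to `Q`. -/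
def IsBoundedMod {A : Type*} [CommRing A] [Algebra ℝ A] (Q : Set A) (a : A) : Prop :=
  ∃ N : ℝ, algebraMap ℝ A N - a ∈ Q ∧ algebraMap ℝ A N + a ∈ Q

namespace IsQuadraticModule

variable {A : Type*} [CommRing A] {Q : Set A}

theorem zero_mem (hQ : IsQuadraticModule Q) : (0 : A) ∈ Q := by
  simpa using hQ.sq_mul_mem 0 hQ.one_mem

theorem sumSq_mul_mem (hQ : IsQuadraticModule Q) {s q : A} (hs : IsSumSq s) (hq : q ∈ Q) :
    s * q ∈ Q := by
  induction hs using IsSumSq.rec' with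
  | zero => simpa using hQ.zero_mem
  | sq_add hx _ h =>
    obtain ⟨y, rfl⟩ := hx
    rw [add_mul, ← sq]
    exact hQ.add_mem (hQ.sq_mul_mem y hq) h

theorem sumSq_mem (hQ : IsQuadraticModule Q) {s : A} (hs : IsSumSq s) : s ∈ Q := by
  simpa using hQ.sumSq_mul_mem hs hQ.one_mem

theorem sq_mem (hQ : IsQuadraticModule Q) (a : A) : a ^ 2 ∈ Q := by
  simpa using hQ.sq_mul_mem a hQ.one_mem

/-- Adjoining the products of one element with all sums of squares. -/
theorem adjoin (hQ : IsQuadraticModule Q) (f : A) :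
    IsQuadraticModule {p | ∃ q ∈ Q, ∃ s, IsSumSq s ∧ p = q + s * f} where
  one_mem := ⟨1, hQ.one_mem, 0, .zero, by ring⟩
  add_mem := by
    rintro _ _ ⟨q, hq, s, hs, rfl⟩ ⟨q', hq', s', hs', rfl⟩
    exact ⟨q + q', hQ.add_mem hq hq', s + s', hs.add hs', by ring⟩
  sq_mul_mem := by
    rintro a _ ⟨q, hq, s, hs, rfl⟩
    refine ⟨a ^ 2 * q, hQ.sq_mul_mem a hq, a ^ 2 * s, ?_, by ring⟩
    rw [sq]
    exact (IsSumSq.mul_self a).mul hs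

variable [Algebra ℝ A]

theorem algebraMap_mul_mem (hQ : IsQuadraticModule Q) {r : ℝ} (hr : 0 ≤ r) {q : A} (hq : q ∈ Q) :
    algebraMap ℝ A r * q ∈ Q := by
  have := hQ.sq_mul_mem (algebraMap ℝ A (Real.sqrt r)) hq
  rwa [← map_pow, Real.sq_sqrt hr] at this

theorem algebraMap_mem (hQ : IsQuadraticModule Q) {r : ℝ} (hr : 0 ≤ r) :
    algebraMap ℝ A r ∈ Q := by
  simpa using hQ.algebraMap_mul_mem hr hQ.one_mem

theorem of_algebraMap_mul_mem (hQ : IsQuadraticModule Q) {r : ℝ} (hr : 0 < r) {q : A}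
    (hq : algebraMap ℝ A r * q ∈ Q) : q ∈ Q := by
  have := hQ.algebraMap_mul_mem (inv_nonneg.2 hr.le) hq
  rwa [← mul_assoc, ← map_mul, inv_mul_cancel₀ hr.ne', map_one, one_mul] at this

theorem nonneg_of_algebraMap_mem (hQ : IsQuadraticModule Q) (hneg : (-1 : A) ∉ Q) {r : ℝ}
    (hr : algebraMap ℝ A r ∈ Q) : 0 ≤ r := by
  by_contra! h
  refine hneg (hQ.of_algebraMap_mul_mem (neg_pos.2 h) ?_)
  simpa using hr

/-- Every element is a difference of squares: `4a = (1 + a)² - (1 - a)²`. Hence a quadratic module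
is proper exactly when it omits `-1`. -/
theorem mem_of_neg_one_mem (hQ : IsQuadraticModule Q) (hneg : (-1 : A) ∈ Q) (a : A) : a ∈ Q := by
  have h1 := hQ.sq_mem (1 + a)
  have h2 := hQ.sq_mul_mem (1 - a) hneg
  refine hQ.of_algebraMap_mul_mem (r := 4) (by norm_num) ?_
  have : algebraMap ℝ A 4 * a = (1 + a) ^ 2 + (1 - a) ^ 2 * -1 := by
    rw [map_ofNat]; ring
  rw [this]
  exact hQ.add_mem h1 h2

/-- A quadratic module need not be closed under products, so each factor is weighted by a square:
`2r(r² - a²) = (r - a)²(r + a) + (r + a)²(r - a)`. -/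
theorem sq_le_sq (hQ : IsQuadraticModule Q) {r : ℝ} (hr : 0 < r) {a : A}
    (h1 : algebraMap ℝ A r - a ∈ Q) (h2 : algebraMap ℝ A r + a ∈ Q) :
    algebraMap ℝ A (r ^ 2) - a ^ 2 ∈ Q := by
  refine hQ.of_algebraMap_mul_mem (r := 2 * r) (by positivity) ?_
  have := hQ.add_mem (hQ.sq_mul_mem (algebraMap ℝ A r - a) h2)
    (hQ.sq_mul_mem (algebraMap ℝ A r + a) h1)
  convert this using 1
  rw [map_mul, map_ofNat, map_pow]
  ring

theorem bounded_mono (hQ : IsQuadraticModule Q) {N N' : ℝ} (hN : N ≤ N') {a : A}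
    (ha : algebraMap ℝ A N + a ∈ Q) : algebraMap ℝ A N' + a ∈ Q := by
  have := hQ.add_mem (hQ.algebraMap_mem (sub_nonneg.2 hN)) ha
  rw [map_sub] at this
  convert this using 1
  ring

theorem isBoundedMod_algebraMap (hQ : IsQuadraticModule Q) (r : ℝ) :
    IsBoundedMod Q (algebraMap ℝ A r) := by
  refine ⟨|r|, ?_, ?_⟩
  · rw [← map_sub]; exact hQ.algebraMap_mem (by linarith [le_abs_self r])
  · rw [← map_add]; exact hQ.algebraMap_mem (by linarith [neg_abs_le r])

theorem isBoundedMod_add (hQ : IsQuadraticModule Q) {a b : A} (ha : IsBoundedMod Q a)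
    (hb : IsBoundedMod Q b) : IsBoundedMod Q (a + b) := by
  obtain ⟨N, h1, h2⟩ := ha
  obtain ⟨M, h3, h4⟩ := hb
  refine ⟨N + M, ?_, ?_⟩
  · convert hQ.add_mem h1 h3 using 1
    rw [map_add]; ring
  · convert hQ.add_mem h2 h4 using 1
    rw [map_add]; ring

theorem isBoundedMod_neg {a : A} (ha : IsBoundedMod Q a) : IsBoundedMod Q (-a) := by
  obtain ⟨N, h1, h2⟩ := ha
  exact ⟨N, by simpa using h2, by simpa [← sub_eq_add_neg] using h1⟩

theorem isBoundedMod_sq (hQ : IsQuadraticModule Q) {a : A} (ha : IsBoundedMod Q a) :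
    IsBoundedMod Q (a ^ 2) := by
  obtain ⟨N, h1, h2⟩ := ha
  have hN : N ≤ |N| + 1 := by linarith [le_abs_self N]
  refine ⟨(|N| + 1) ^ 2, hQ.sq_le_sq (by positivity) ?_ (hQ.bounded_mono hN h2),
    hQ.add_mem (hQ.algebraMap_mem (sq_nonneg _)) (hQ.sq_mem a)⟩
  simpa [sub_eq_add_neg] using hQ.bounded_mono hN (a := -a) (by simpa [← sub_eq_add_neg] using h1)

/-- Polarization, `4ab = (a + b)² - (a - b)²`, reduces products to squares. The bounded elements
thus form a subalgebra, and boundedness need only be checked on generators. -/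
theorem isBoundedMod_mul (hQ : IsQuadraticModule Q) {a b : A} (ha : IsBoundedMod Q a)
    (hb : IsBoundedMod Q b) : IsBoundedMod Q (a * b) := by
  obtain ⟨N, h1, h2⟩ := hQ.isBoundedMod_add (hQ.isBoundedMod_sq (hQ.isBoundedMod_add ha hb))
    (isBoundedMod_neg (hQ.isBoundedMod_sq
      (hQ.isBoundedMod_add ha (isBoundedMod_neg hb))))
  refine ⟨N / 4, ?_, ?_⟩ <;> refine hQ.of_algebraMap_mul_mem (r := 4) (by norm_num) ?_
  · convert h1 using 1
    rw [mul_sub, ← map_mul, mul_div_cancel₀ _ (by norm_num), map_ofNat]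
    ring
  · convert h2 using 1
    rw [mul_add, ← map_mul, mul_div_cancel₀ _ (by norm_num), map_ofNat]
    ring

/-- Completing the square: `N + 1 ∓ 2a = (N - a²) + (a ∓ 1)²`. -/
theorem isBoundedMod_of_sq_le (hQ : IsQuadraticModule Q) {a : A} {N : ℝ}
    (h : algebraMap ℝ A N - a ^ 2 ∈ Q) : IsBoundedMod Q a := by
  refine ⟨(N + 1) / 2, ?_, ?_⟩ <;> refine hQ.of_algebraMap_mul_mem (r := 2) (by norm_num) ?_
  · convert hQ.add_mem h (hQ.sq_mem (a - 1)) using 1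
    rw [mul_sub, ← map_mul, mul_div_cancel₀ _ (by norm_num), map_ofNat, map_add, map_one]
    ring
  · convert hQ.add_mem h (hQ.sq_mem (a + 1)) using 1
    rw [mul_add, ← map_mul, mul_div_cancel₀ _ (by norm_num), map_ofNat, map_add, map_one]
    ring

/-- A maximal proper quadratic module is total: it contains every element or its negative. -/
theorem total_of_maximal (hQ : IsQuadraticModule Q) (hneg : (-1 : A) ∉ Q)
    (hmax : ∀ Q' : Set A, IsQuadraticModule Q' → (-1 : A) ∉ Q' → Q ⊆ Q' → Q' ⊆ Q) (a : A) :
    a ∈ Q ∨ -a ∈ Q := by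
  have key : ∀ f : A, f ∉ Q → ∃ q ∈ Q, ∃ s, IsSumSq s ∧ -1 = q + s * f := by
    intro f hf
    by_contra hcon
    refine hf (hmax _ (hQ.adjoin f) hcon (fun q hq => ⟨q, hq, 0, .zero, by ring⟩) ?_)
    exact ⟨0, hQ.zero_mem, 1, .one, by ring⟩
  by_contra! hcon
  obtain ⟨q₁, hq₁, s₁, hs₁, h₁⟩ := key a hcon.1
  obtain ⟨q₂, hq₂, s₂, hs₂, h₂⟩ := key (-a) hcon.2
  -- Eliminating `a` from the two representations of `-1` puts `-s₁` in `Q` along with `s₁`. Then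
  -- `s₁ * a` lies in `Q` as well, and `h₁` exhibits `-1` as an element of `Q`.
  have hmem : -s₁ ∈ Q := by
    have : -s₁ = s₂ + (s₂ * q₁ + s₁ * q₂) := by linear_combination s₂ * h₁ + s₁ * h₂
    rw [this]
    exact hQ.add_mem (hQ.sumSq_mem hs₂)
      (hQ.add_mem (hQ.sumSq_mul_mem hs₂ hq₁) (hQ.sumSq_mul_mem hs₁ hq₂))
  have hsa : s₁ * a ∈ Q := by
    refine hQ.of_algebraMap_mul_mem (r := 4) (by norm_num) ?_
    have : algebraMap ℝ A 4 * (s₁ * a) = (a + 1) ^ 2 * s₁ + (a - 1) ^ 2 * -s₁ := by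
      rw [map_ofNat]; ring
    rw [this]
    exact hQ.add_mem (hQ.sq_mul_mem _ (hQ.sumSq_mem hs₁)) (hQ.sq_mul_mem _ hmem)
  exact hneg (h₁ ▸ hQ.add_mem hq₁ hsa)

/-- An Archimedean proper quadratic module is nonnegative under some real character. -/
theorem exists_character (hQ : IsQuadraticModule Q) (harch : ∀ a : A, IsBoundedMod Q a)
    (hneg : (-1 : A) ∉ Q) : ∃ φ : A →ₐ[ℝ] ℝ, ∀ q ∈ Q, 0 ≤ φ q := by
  obtain ⟨M, hQM, hM⟩ := zorn_subset_nonempty {Q' : Set A | IsQuadraticModule Q' ∧ (-1 : A) ∉ Q'}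
    (by
      intro c hc hchain hne
      refine ⟨⋃₀ c, ⟨⟨?_, ?_, ?_⟩, ?_⟩, fun s hs => Set.subset_sUnion_of_mem hs⟩
      · obtain ⟨s, hs⟩ := hne
        exact ⟨s, hs, (hc hs).1.one_mem⟩
      · rintro p q ⟨s, hs, hp⟩ ⟨t, ht, hq⟩
        rcases hchain.total hs ht with h | h
        · exact ⟨t, ht, (hc ht).1.add_mem (h hp) hq⟩
        · exact ⟨s, hs, (hc hs).1.add_mem hp (h hq)⟩
      · rintro a q ⟨s, hs, hq⟩
        exact ⟨s, hs, (hc hs).1.sq_mul_mem a hq⟩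
      · rintro ⟨s, hs, h⟩
        exact (hc hs).2 h) Q ⟨hQ, hneg⟩
  obtain ⟨⟨hMQ, hMneg⟩, hMmax⟩ := hM
  have htot := hMQ.total_of_maximal hMneg fun Q' h1 h2 h3 => hMmax ⟨h1, h2⟩ h3
  let c := algebraMap ℝ A
  -- `near a t` says that `a - t` is infinitesimal for the maximal module `M`. The character sends
  -- `a` to the unique such `t`, its standard part.
  let near (a : A) (t : ℝ) : Prop := ∀ ε > 0, c ε + (a - c t) ∈ M ∧ c ε - (a - c t) ∈ M
  have near_iff : ∀ {a t}, near a t ↔ near (a - c t) 0 := by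
    intro a t
    simp [near]
  have near_unique : ∀ {a t t'}, near a t → near a t' → t ≤ t' := by
    intro a t t' h h'
    refine le_of_forall_pos_le_add fun ε hε => ?_
    have := hMQ.add_mem (h (ε / 2) (half_pos hε)).1 (h' (ε / 2) (half_pos hε)).2
    have h2 : c (ε / 2) + (a - c t) + (c (ε / 2) - (a - c t')) = c (t' + ε - t) := by
      rw [map_sub, map_add, show c ε = c (ε / 2) + c (ε / 2) by rw [← map_add, add_halves]]
      ring
    rw [h2] at this
    linarith [hMQ.nonneg_of_algebraMap_mem hMneg this]
  have near_add : ∀ {a b t u}, near a t → near b u → near (a + b) (t + u) := by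
    intro a b t u ha hb ε hε
    have hc : c ε = c (ε / 2) + c (ε / 2) := by rw [← map_add, add_halves]
    rw [hc, map_add]
    constructor
    · convert hMQ.add_mem (ha _ (half_pos hε)).1 (hb _ (half_pos hε)).1 using 1
      ring
    · convert hMQ.add_mem (ha _ (half_pos hε)).2 (hb _ (half_pos hε)).2 using 1
      ring
  have near_sq : ∀ {a}, near a 0 → near (a ^ 2) 0 := by
    intro a ha ε hε
    have h1 := ha (Real.sqrt ε) (Real.sqrt_pos.2 hε)
    rw [map_zero, sub_zero] at h1 ⊢
    refine ⟨hMQ.add_mem (hMQ.algebraMap_mem hε.le) (hMQ.sq_mem a), ?_⟩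
    have := hMQ.sq_le_sq (Real.sqrt_pos.2 hε) h1.2 h1.1
    rwa [Real.sq_sqrt hε.le] at this
  have near_neg : ∀ {a}, near a 0 → near (-a) 0 := by
    intro a ha ε hε
    have := ha ε hε
    simp only [map_zero, sub_zero, sub_neg_eq_add, ← sub_eq_add_neg] at this ⊢
    exact this.symm
  have near_smul : ∀ {a} {r : ℝ}, 0 < r → near a 0 → near (c r * a) 0 := by
    intro a r hr ha ε hε
    have h := ha (ε / r) (by positivity)
    have hc : c ε = c r * c (ε / r) := by rw [← map_mul, mul_div_cancel₀ _ hr.ne']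
    rw [map_zero, sub_zero] at h ⊢
    rw [hc, ← mul_add, ← mul_sub]
    exact ⟨hMQ.algebraMap_mul_mem hr.le h.1, hMQ.algebraMap_mul_mem hr.le h.2⟩
  have near_zero : near 0 0 := by
    intro ε hε
    simpa [c] using hMQ.algebraMap_mem hε.le
  have near_smul' : ∀ {a} (r : ℝ), near a 0 → near (c r * a) 0 := by
    intro a r ha
    rcases lt_trichotomy r 0 with hr | rfl | hr
    · simpa using near_neg (near_smul (neg_pos.2 hr) ha)
    · simpa using near_zero
    · exact near_smul hr ha
  have near_mul : ∀ {a b t u}, near a t → near b u → near (a * b) (t * u) := by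
    intro a b t u ha hb
    rw [near_iff] at ha hb ⊢
    have hadd : ∀ {x y}, near x 0 → near y 0 → near (x + y) 0 := by
      intro x y hx hy
      simpa using near_add hx hy
    have h1 := near_smul (r := 4⁻¹) (by norm_num)
      (hadd (near_sq (hadd ha hb)) (near_neg (near_sq (hadd ha (near_neg hb)))))
    have h2 := hadd h1 (hadd (near_smul' u ha) (near_smul' t hb))
    convert h2 using 1
    have h4 : c 4⁻¹ * 4 = 1 := by
      rw [← map_ofNat c 4, ← map_mul]; norm_num
    rw [map_mul]
    linear_combination (-(a - c t) * (b - c u)) * h4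
  have near_algebraMap : ∀ r, near (c r) r := by
    intro r
    rw [near_iff, sub_self]
    exact near_zero
  have hex : ∀ a, ∃ t, near a t := by
    intro a
    obtain ⟨N, hN1, hN2⟩ := harch a
    -- The standard part is the supremum of the constants below `a`. Totality of `M` gives the upper
    -- estimate: if it failed, `sSup S + ε` would belong to `S`.
    let S := {r : ℝ | a - c r ∈ M}
    have hne : S.Nonempty := ⟨-N, by
      change a - c (-N) ∈ M
      rw [map_neg, sub_neg_eq_add, add_comm]
      exact hQM hN2⟩
    have hbdd : BddAbove S := ⟨N, fun r hr => by
      have := hMQ.add_mem (hQM hN1) hr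
      rw [sub_add_sub_cancel, ← map_sub] at this
      linarith [hMQ.nonneg_of_algebraMap_mem hMneg this]⟩
    refine ⟨sSup S, fun ε hε => ⟨?_, ?_⟩⟩
    · obtain ⟨r, hr, hlt⟩ := exists_lt_of_lt_csSup hne (show sSup S - ε < sSup S by linarith)
      have := hMQ.add_mem (hMQ.algebraMap_mem (show 0 ≤ r - (sSup S - ε) by linarith)) hr
      rw [map_sub, map_sub] at this
      convert this using 1
      ring
    · rcases htot (c ε - (a - c (sSup S))) with h | h
      · exact h
      · have : sSup S + ε ∈ S := by
          change a - c (sSup S + ε) ∈ M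
          convert h using 1
          rw [map_add]; ring
        linarith [le_csSup hbdd this]
  choose α hα using hex
  have huniq : ∀ {a t}, near a t → α a = t := fun h =>
    le_antisymm (near_unique (hα _) h) (near_unique h (hα _))
  refine ⟨{ toFun := α
            map_one' := huniq (by simpa [c] using near_algebraMap 1)
            map_mul' := fun a b => huniq (near_mul (hα a) (hα b))
            map_zero' := huniq near_zero
            map_add' := fun a b => huniq (near_add (hα a) (hα b))
            commutes' := fun r => huniq (near_algebraMap r) }, fun q hq => ?_⟩
  change 0 ≤ α q
  refine le_of_forall_pos_le_add fun ε hε => ?_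
  have := hMQ.add_mem (hQM hq) (hα q ε hε).2
  rw [show q + (c ε - (q - c (α q))) = c (α q + ε) by rw [map_add]; ring] at this
  exact hMQ.nonneg_of_algebraMap_mem hMneg this

/-- The abstract Positivstellensatz for Archimedean quadratic modules: an element that is positive
under every real character which is nonnegative on the module belongs to the module. -/
theorem mem_of_forall_character_pos (hQ : IsQuadraticModule Q)
    (harch : ∀ a : A, IsBoundedMod Q a) {f : A}
    (hf : ∀ φ : A →ₐ[ℝ] ℝ, (∀ q ∈ Q, 0 ≤ φ q) → 0 < φ f) : f ∈ Q := by
  -- If adjoining `-f` left the module proper, a character would be nonnegative on `Q` and on `-f`,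
  -- against `hf`. So `p * f = 1 + q` for a sum of squares `p` and some `q ∈ Q`; what remains is to
  -- cancel `p`.
  have hneg : (-1 : A) ∈ {p | ∃ q ∈ Q, ∃ s, IsSumSq s ∧ p = q + s * -f} := by
    by_contra hcon
    have hsub : ∀ q ∈ Q, q ∈ {p | ∃ q ∈ Q, ∃ s, IsSumSq s ∧ p = q + s * -f} :=
      fun q hq => ⟨q, hq, 0, .zero, by ring⟩
    obtain ⟨φ, hφ⟩ := (hQ.adjoin (-f)).exists_character
      (fun a => (harch a).imp fun N h => ⟨hsub _ h.1, hsub _ h.2⟩) hcon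
    have h1 := hf φ fun q hq => hφ q (hsub q hq)
    have h2 := hφ (-f) ⟨0, hQ.zero_mem, 1, .one, by ring⟩
    rw [map_neg] at h2
    linarith
  obtain ⟨q, hq, p, hp, hqp⟩ := hneg
  let c := algebraMap ℝ A
  have hpf : p * f - 1 ∈ Q := by
    convert hq using 1
    linear_combination hqp
  obtain ⟨k, hk, hk1, hk2⟩ : ∃ k : ℝ, 0 < k ∧ c (2 * k) - p ∈ Q ∧
      c (2 * k - 1) - p ^ 2 * f ∈ Q := by
    obtain ⟨N₁, h₁, -⟩ := harch p
    obtain ⟨N₂, h₂, -⟩ := harch (p ^ 2 * f)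
    refine ⟨|N₁| + |N₂| + 1, by positivity, ?_, ?_⟩
    · rw [sub_eq_add_neg] at h₁ ⊢
      refine hQ.bounded_mono ?_ h₁
      linarith [le_abs_self N₁, abs_nonneg N₁, abs_nonneg N₂]
    · rw [sub_eq_add_neg] at h₂ ⊢
      refine hQ.bounded_mono ?_ h₂
      linarith [le_abs_self N₂, abs_nonneg N₁, abs_nonneg N₂]
  have hpk : p * (c (2 * k) - p) ∈ Q := by
    refine hQ.of_algebraMap_mul_mem (r := 2 * k) (by positivity) ?_
    convert hQ.add_mem (hQ.sq_mul_mem p hk1)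
      (hQ.sq_mul_mem (c (2 * k) - p) (hQ.sumSq_mem hp)) using 1
    ring
  -- Descent by a fixed amount: `k²(f + r) - 1` equals `(k - p)²(f + r) + 2k(pf - 1) + r p(2k - p) +
  -- (2k - 1 - p²f)`, and each summand is in `Q`.
  have hstep : ∀ r : ℝ, 0 ≤ r → f + c r ∈ Q → f + c (r - 1 / k ^ 2) ∈ Q := by
    intro r hr hfr
    refine hQ.of_algebraMap_mul_mem (r := k ^ 2) (by positivity) ?_
    convert hQ.add_mem (hQ.add_mem (hQ.sq_mul_mem (c k - p) hfr)
      (hQ.algebraMap_mul_mem (r := 2 * k) (by positivity) hpf))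
      (hQ.add_mem (hQ.algebraMap_mul_mem hr hpk) hk2) using 1
    rw [mul_add, ← map_mul, mul_sub, mul_one_div_cancel (by positivity)]
    simp only [map_mul, map_sub, map_pow, map_ofNat, map_one, c]
    ring
  have hδ : 0 < 1 / k ^ 2 := by positivity
  obtain ⟨N, -, hN⟩ := harch f
  -- Truncation at `0` keeps the constant in the range `r ≥ 0` that `hstep` requires.
  have hiter : ∀ j : ℕ, f + c (max 0 (N - j * (1 / k ^ 2))) ∈ Q := by
    intro j
    induction j with
    | zero =>
      rw [add_comm]
      exact hQ.bounded_mono (by simp) hN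
    | succ j ih =>
      have := hstep _ (le_max_left _ _) ih
      rw [add_comm] at this ⊢
      refine hQ.bounded_mono ?_ this
      rcases le_total 0 (N - j * (1 / k ^ 2)) with h | h
      · rw [max_eq_right h]
        refine le_max_of_le_right (le_of_eq ?_)
        push_cast; ring
      · rw [max_eq_left h]
        exact le_max_of_le_left (by linarith)
  obtain ⟨j, hj⟩ := exists_nat_ge (N / (1 / k ^ 2))
  have := hiter j
  rwa [max_eq_left (by rw [div_le_iff₀ hδ] at hj; linarith), map_zero, add_zero] at this

end IsQuadraticModule

/-! ### Putinar's theorem for polynomial rings -/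

open MvPolynomial

/-- The quadratic module generated by a finite family of polynomials. -/
def quadraticModule {σ ι : Type*} [Fintype ι] (g : ι → MvPolynomial σ ℝ) :
    Set (MvPolynomial σ ℝ) :=
  {p | ∃ (lam₀ : MvPolynomial σ ℝ) (lam : ι → MvPolynomial σ ℝ),
    IsSumSq lam₀ ∧ (∀ i, IsSumSq (lam i)) ∧ p = lam₀ + ∑ i, lam i * g i}

theorem isQuadraticModule_quadraticModule {σ ι : Type*} [Fintype ι]
    (g : ι → MvPolynomial σ ℝ) : IsQuadraticModule (quadraticModule g) where
  one_mem := ⟨1, 0, .one, fun _ => .zero, by simp⟩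
  add_mem := by
    rintro _ _ ⟨a, l, ha, hl, rfl⟩ ⟨a', l', ha', hl', rfl⟩
    refine ⟨a + a', l + l', ha.add ha', fun i => (hl i).add (hl' i), ?_⟩
    simp only [Pi.add_apply, add_mul, Finset.sum_add_distrib]
    ring
  sq_mul_mem := by
    rintro b _ ⟨a, l, ha, hl, rfl⟩
    have hb : IsSumSq (b ^ 2) := by rw [sq]; exact .mul_self b
    refine ⟨b ^ 2 * a, fun i => b ^ 2 * l i, hb.mul ha, fun i => hb.mul (hl i), ?_⟩
    rw [mul_add, Finset.mul_sum]
    simp only [mul_assoc]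

theorem self_mem_quadraticModule {σ ι : Type*} [Fintype ι] (g : ι → MvPolynomial σ ℝ) (i : ι) :
    g i ∈ quadraticModule g := by
  classical
  refine ⟨0, Pi.single i 1, .zero, fun j => ?_, ?_⟩
  · by_cases h : j = i
    · subst h; simp
    · rw [Pi.single_eq_of_ne h]; exact .zero
  · rw [zero_add, Finset.sum_eq_single i] <;> simp +contextual

/-- **Putinar's Positivstellensatz**: if every variable is bounded modulo the quadratic module
generated by `g`, then every polynomial that is positive on `{x | ∀ i, 0 ≤ gᵢ(x)}` belongs to that
module. -/
theorem putinar {σ ι : Type*} [Fintype ι] (g : ι → MvPolynomial σ ℝ)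
    (hX : ∀ k, IsBoundedMod (quadraticModule g) (X k : MvPolynomial σ ℝ)) {f : MvPolynomial σ ℝ}
    (hf : ∀ x : σ → ℝ, (∀ i, 0 ≤ eval x (g i)) → 0 < eval x f) : f ∈ quadraticModule g := by
  have hQ := isQuadraticModule_quadraticModule g
  refine hQ.mem_of_forall_character_pos (fun a => ?_) fun φ hφ => ?_
  · induction a using MvPolynomial.induction_on with
    | C r => exact hQ.isBoundedMod_algebraMap r
    | add p q hp hq => exact hQ.isBoundedMod_add hp hq
    | mul_X p k hp => exact hQ.isBoundedMod_mul hp (hX k)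
  · have heval : ∀ p, φ p = eval (fun k => φ (X k)) p := by
      intro p
      have : φ = aeval fun k => φ (X k) := MvPolynomial.algHom_ext (by simp)
      rw [DFunLike.congr_fun this p]
      rfl
    rw [heval]
    refine hf _ fun i => ?_
    rw [← heval]
    exact hφ _ (self_mem_quadraticModule g i)

/-- A homomorphic image of a bounded element is bounded when generators are mapped into the
target quadratic module. -/
theorem IsBoundedMod.map {σ τ ι κ : Type*} [Fintype ι] [Fintype κ] {g : ι → MvPolynomial σ ℝ}
    {h : κ → MvPolynomial τ ℝ} (φ : MvPolynomial σ ℝ →ₐ[ℝ] MvPolynomial τ ℝ)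
    (hφ : ∀ i, φ (g i) ∈ quadraticModule h) {a : MvPolynomial σ ℝ}
    (ha : IsBoundedMod (quadraticModule g) a) : IsBoundedMod (quadraticModule h) (φ a) := by
  have hQ := isQuadraticModule_quadraticModule h
  have hs : ∀ s : MvPolynomial σ ℝ, IsSumSq s → IsSumSq (φ s) := by
    intro s hs
    induction hs using IsSumSq.rec' with
    | zero => rw [map_zero]; exact .zero
    | sq_add hx _ ih =>
      obtain ⟨y, rfl⟩ := hx
      rw [map_add, map_mul]
      exact (IsSumSq.mul_self _).add ih
  have key : ∀ p ∈ quadraticModule g, φ p ∈ quadraticModule h := by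
    rintro _ ⟨a, l, ha, hl, rfl⟩
    rw [map_add, map_sum]
    refine hQ.add_mem (hQ.sumSq_mem (hs _ ha)) ?_
    refine Finset.sum_induction _ (· ∈ quadraticModule h) (fun _ _ => hQ.add_mem) hQ.zero_mem ?_
    intro i _
    rw [map_mul]
    exact hQ.sumSq_mul_mem (hs _ (hl i)) (hφ i)
  obtain ⟨N, h1, h2⟩ := ha
  refine ⟨N, ?_, ?_⟩
  · simpa using key _ h1
  · simpa using key _ h2


/-! ### Farkas' lemma and the Archimedean property of bounded polyhedra -/

open MvPolynomial

/-- **Farkas' lemma** for finitely many linear functionals. -/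
theorem farkas {V : Type*} [AddCommGroup V] [Module ℝ V] (m : ℕ) (f : Fin m → V →ₗ[ℝ] ℝ)
    (g : V →ₗ[ℝ] ℝ) (h : ∀ x, (∀ i, 0 ≤ f i x) → 0 ≤ g x) :
    ∃ c : Fin m → ℝ, (∀ i, 0 ≤ c i) ∧ g = ∑ i, c i • f i := by
  induction m generalizing g with
  | zero =>
    refine ⟨0, fun i => le_rfl, LinearMap.ext fun x => ?_⟩
    have h1 := h x (fun i => i.elim0)
    have h2 := h (-x) (fun i => i.elim0)
    rw [map_neg] at h2
    simp only [Finset.univ_eq_empty, Finset.sum_empty, LinearMap.zero_apply]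
    linarith
  | succ m ih =>
    by_cases hg : ∀ x, (∀ i : Fin m, 0 ≤ f i.succ x) → 0 ≤ g x
    · obtain ⟨c, hc, hgc⟩ := ih (fun i => f i.succ) g hg
      refine ⟨Fin.cons 0 c, fun i => ?_, ?_⟩
      · refine Fin.cases ?_ (fun i => ?_) i
        · simp
        · simpa using hc i
      · rw [Fin.sum_univ_succ]
        simpa using hgc
    · push Not at hg
      obtain ⟨x₀, hx₀, hgx₀⟩ := hg
      have hf0 : f 0 x₀ < 0 := by
        by_contra! hcon
        exact absurd (h x₀ fun i => Fin.cases hcon hx₀ i) (not_le.2 hgx₀)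
      set t := f 0 x₀ with ht
      -- Each functional is composed with the projection along `x₀` onto the kernel of `f 0`, where
      -- the constraint `f 0` is vacuous and induction applies.
      obtain ⟨c, hc, hgc⟩ := ih (fun i => f i.succ - (f i.succ x₀ / t) • f 0)
        (g - (g x₀ / t) • f 0) (by
          intro x hx
          have key : ∀ φ : V →ₗ[ℝ] ℝ, (φ - (φ x₀ / t) • f 0) x = φ (x - (f 0 x / t) • x₀) := by
            intro φ
            simp only [LinearMap.sub_apply, LinearMap.smul_apply, map_sub, map_smul, smul_eq_mul]
            ring
          rw [key]
          refine h _ fun i => Fin.cases ?_ (fun i => ?_) i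
          · rw [map_sub, map_smul, smul_eq_mul, ← ht, div_mul_cancel₀ _ hf0.ne, sub_self]
          · rw [← key]
            exact hx i)
      refine ⟨Fin.cons (g x₀ / t - ∑ i, c i * (f i.succ x₀ / t)) c, fun i => ?_, ?_⟩
      · refine Fin.cases ?_ (fun i => ?_) i
        · rw [Fin.cons_zero]
          have h1 : 0 ≤ g x₀ / t := div_nonneg_of_nonpos hgx₀.le hf0.le
          have h2 : ∑ i, c i * (f i.succ x₀ / t) ≤ 0 := Finset.sum_nonpos fun i _ =>
            mul_nonpos_of_nonneg_of_nonpos (hc i) (div_nonpos_of_nonneg_of_nonpos (hx₀ i) hf0.le)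
          linarith
        · simpa using hc i
      · rw [Fin.sum_univ_succ]
        simp only [Fin.cons_zero, Fin.cons_succ]
        rw [sub_eq_iff_eq_add] at hgc
        refine hgc.trans ?_
        refine LinearMap.ext fun x => ?_
        simp only [LinearMap.add_apply, LinearMap.sum_apply, LinearMap.smul_apply,
          LinearMap.sub_apply, smul_eq_mul, mul_sub, Finset.sum_sub_distrib, sub_mul,
          Finset.sum_mul, mul_assoc]
        abel

theorem eval_slack {n m : ℕ} (Cm : Matrix (Fin m) (Fin n) ℝ) (d : Fin m → ℝ) (j : Fin m)
    (s : Fin n → ℝ) : eval s (slack Cm d j) = d j - Cm.mulVec s j := by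
  simp [slack, Matrix.mulVec, dotProduct]

theorem mem_polyhedron_iff {n m : ℕ} {Cm : Matrix (Fin m) (Fin n) ℝ} {d : Fin m → ℝ}
    {s : Fin n → ℝ} : s ∈ polyhedron Cm d ↔ ∀ j, 0 ≤ eval s (slack Cm d j) := by
  simp [eval_slack, polyhedron, Pi.le_def]

/-- An affine function that is nonnegative on the homogenization of a polyhedron belongs to the
quadratic module generated by the facet inequalities. -/
theorem affine_mem_quadraticModule {n m : ℕ} (Cm : Matrix (Fin m) (Fin n) ℝ) (d : Fin m → ℝ)
    (g : (Fin n → ℝ) × ℝ →ₗ[ℝ] ℝ)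
    (hg : ∀ s t, 0 ≤ t → Cm.mulVec s ≤ t • d → 0 ≤ g (s, t)) (p : MvPolynomial (Fin n) ℝ)
    (hp : ∀ s, eval s p = g (s, 1)) : p ∈ quadraticModule (slack Cm d) := by
  -- Farkas is applied to the cone `t ≥ 0`, `C s ≤ t d`. Setting `t = 1` turns the multiplier of `t`
  -- into the constant `λ₀`.
  obtain ⟨c, hc, hgc⟩ := farkas (m + 1)
    (Fin.cons (LinearMap.snd ℝ _ ℝ) fun j => d j • LinearMap.snd ℝ (Fin n → ℝ) ℝ -
      (LinearMap.proj j ∘ₗ Cm.mulVecLin) ∘ₗ LinearMap.fst ℝ _ ℝ) g (by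
    rintro ⟨s, t⟩ h
    refine hg s t (by simpa using h 0) fun j => ?_
    have := h j.succ
    simp only [Fin.cons_succ, LinearMap.sub_apply, LinearMap.smul_apply, LinearMap.snd_apply,
      LinearMap.comp_apply, LinearMap.fst_apply, Matrix.mulVecLin_apply, LinearMap.proj_apply,
      smul_eq_mul] at this
    simp only [Pi.smul_apply, smul_eq_mul]
    linarith)
  have hconst : ∀ r : ℝ, 0 ≤ r → IsSumSq (C r : MvPolynomial (Fin n) ℝ) := by
    intro r hr
    rw [← Real.mul_self_sqrt hr, C_mul]
    exact .mul_self _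
  refine ⟨C (c 0), fun j => C (c j.succ), hconst _ (hc 0), fun j => hconst _ (hc _), ?_⟩
  refine MvPolynomial.funext fun s => ?_
  rw [hp, hgc, Fin.sum_univ_succ]
  simp [eval_slack]

/-- The facet inequalities of a bounded polyhedron generate an Archimedean quadratic module. -/
theorem isBoundedMod_slack {n m : ℕ} {Cm : Matrix (Fin m) (Fin n) ℝ} {d : Fin m → ℝ}
    {sl su : Fin n → ℝ} (hlim : polyhedron Cm d ⊆ jointLimitBox sl su) (k : Fin n) :
    IsBoundedMod (quadraticModule (slack Cm d)) (X k) := by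
  have hQ := isQuadraticModule_quadraticModule (slack Cm d)
  have hhom : ∀ (s : Fin n → ℝ) (t : ℝ), 0 < t → Cm.mulVec s ≤ t • d → t⁻¹ • s ∈ polyhedron Cm d := by
    intro s t ht h
    change Cm.mulVec (t⁻¹ • s) ≤ d
    rw [Matrix.mulVec_smul]
    have := smul_le_smul_of_nonneg_left h (inv_nonneg.2 ht.le)
    rwa [smul_smul, inv_mul_cancel₀ ht.ne', one_smul] at this
  rcases (polyhedron Cm d).eq_empty_or_nonempty with hP | ⟨s₀, hs₀⟩
  · have hneg : (-1 : MvPolynomial (Fin n) ℝ) ∈ quadraticModule (slack Cm d) := by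
      refine affine_mem_quadraticModule Cm d (-LinearMap.snd ℝ _ ℝ) (fun s t ht h => ?_) _ (by simp)
      rcases ht.eq_or_lt with rfl | ht
      · simp
      · have := hhom s t ht h
        rw [hP] at this
        exact this.elim
    exact ⟨0, hQ.mem_of_neg_one_mem hneg _, hQ.mem_of_neg_one_mem hneg _⟩
  -- A recession direction with a nonzero `k`-th coordinate would leave the box. This settles `t =
  -- 0` in the homogenized inequality; for `t > 0` one rescales to a point of the polyhedron.
  · have hrec : ∀ s, Cm.mulVec s ≤ 0 → s k = 0 := by
      intro s hs
      have hmem : ∀ r : ℝ, 0 ≤ r → s₀ + r • s ∈ jointLimitBox sl su := by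
        intro r hr
        refine hlim ?_
        change Cm.mulVec (s₀ + r • s) ≤ d
        rw [Matrix.mulVec_add, Matrix.mulVec_smul]
        have h1 : r • Cm.mulVec s ≤ 0 := smul_nonpos_of_nonneg_of_nonpos hr hs
        have h2 : Cm.mulVec s₀ ≤ d := hs₀
        simpa using add_le_add h2 h1
      have hb : ∀ r : ℝ, 0 ≤ r → sl k ≤ s₀ k + r * s k ∧ s₀ k + r * s k ≤ su k := by
        intro r hr
        exact ⟨(hmem r hr).1 k, (hmem r hr).2 k⟩
      have h0 := hb 0 le_rfl
      rw [zero_mul, add_zero] at h0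
      by_contra hne
      have hpos : 0 < |s k| := abs_pos.2 hne
      have h1 := hb ((su k - sl k + 1) / |s k|) (div_nonneg (by linarith) hpos.le)
      rcases abs_cases (s k) with ⟨h, _⟩ | ⟨h, _⟩
      · rw [h, div_mul_cancel₀ _ hne] at h1
        linarith
      · rw [h, div_neg, neg_mul, div_mul_cancel₀ _ hne] at h1
        linarith
    set N := max (su k) (-sl k)
    have hN : ∀ s ∈ polyhedron Cm d, 0 ≤ N - s k ∧ 0 ≤ N + s k := by
      intro s hs
      have h1 := (hlim hs).1 k
      have h2 := (hlim hs).2 k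
      exact ⟨by linarith [le_max_left (su k) (-sl k)], by linarith [le_max_right (su k) (-sl k)]⟩
    let π : (Fin n → ℝ) × ℝ →ₗ[ℝ] ℝ := LinearMap.proj k ∘ₗ LinearMap.fst ℝ (Fin n → ℝ) ℝ
    have main : ∀ ε : ℝ, (∀ s ∈ polyhedron Cm d, 0 ≤ N + ε * s k) →
        (C N + C ε * X k : MvPolynomial (Fin n) ℝ) ∈ quadraticModule (slack Cm d) := by
      intro ε hε
      refine affine_mem_quadraticModule Cm d (N • LinearMap.snd ℝ _ ℝ + ε • π)
        (fun s t ht h => ?_) _ (by simp [π])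
      simp only [LinearMap.add_apply, LinearMap.smul_apply, LinearMap.snd_apply, smul_eq_mul, π,
        LinearMap.comp_apply, LinearMap.fst_apply, LinearMap.proj_apply]
      rcases ht.eq_or_lt with rfl | ht
      · rw [zero_smul] at h
        rw [hrec s h]
        simp
      · have := mul_nonneg ht.le (hε _ (hhom s t ht h))
        rw [Pi.smul_apply, smul_eq_mul, mul_add, mul_left_comm t, mul_inv_cancel_left₀ ht.ne'] at this
        linarith
    refine ⟨N, ?_, ?_⟩
    · simpa [sub_eq_add_neg, algebraMap_eq] using main (-1) fun s hs => by linarith [(hN s hs).1]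
    · simpa [algebraMap_eq] using main 1 fun s hs => by linarith [(hN s hs).2]


/-! ### From strict positivity to certificates -/

open MvPolynomial Filter

/-- `N - x_k²` is the given element plus the squares of the other variables. The map `e` allows the
bound to involve only one block of variables, such as `u` among `(u, s)`. -/
theorem isBoundedMod_of_sum_sq_le {σ τ ι : Type*} [Fintype ι] [Fintype τ]
    {g : ι → MvPolynomial σ ℝ} (e : τ → σ) {N : ℝ}
    (h : (C N - ∑ k, X (e k) ^ 2 : MvPolynomial σ ℝ) ∈ quadraticModule g) (k : τ) :
    IsBoundedMod (quadraticModule g) (X (e k)) := by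
  classical
  have hQ := isQuadraticModule_quadraticModule g
  refine hQ.isBoundedMod_of_sq_le (N := N) ?_
  have h2 : ∑ l ∈ Finset.univ.erase k, (X (e l) : MvPolynomial σ ℝ) ^ 2 ∈ quadraticModule g :=
    Finset.sum_induction _ (· ∈ quadraticModule g) (fun _ _ => hQ.add_mem) hQ.zero_mem
      fun l _ => hQ.sq_mem _
  convert hQ.add_mem h h2 using 1
  rw [← Finset.add_sum_erase _ _ (Finset.mem_univ k), algebraMap_eq]
  ring

theorem IsArchimedean.isBoundedMod {σ : Type*} [Fintype σ] {m : ℕ} {g : Fin m → MvPolynomial σ ℝ}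
    (h : IsArchimedean g) (k : σ) : IsBoundedMod (quadraticModule g) (X k) := by
  obtain ⟨N, lam₀, lam, h₀, h₁, h₂⟩ := h
  exact isBoundedMod_of_sum_sq_le id ⟨lam₀, lam, h₀, h₁, h₂⟩ k

section

variable {n m : ℕ} {Cm : Matrix (Fin m) (Fin n) ℝ} {d : Fin m → ℝ} {sl su : Fin n → ℝ}

theorem eventually_scalarCert (hlim : polyhedron Cm d ⊆ jointLimitBox sl su)
    {p : MvPolynomial (Fin n) ℝ} (hp : ∀ s ∈ polyhedron Cm d, 0 < eval s p) :
    ∀ᶠ ρ in atTop, ScalarCert Cm d ρ p := by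
  obtain ⟨lam₀, lam, h₀, h₁, h₂⟩ := putinar (slack Cm d) (isBoundedMod_slack hlim)
    fun s hs => hp s (mem_polyhedron_iff.2 hs)
  filter_upwards [eventually_ge_atTop lam₀.totalDegree,
    eventually_all.2 fun j => eventually_ge_atTop (lam j).totalDegree] with ρ hρ hρ'
  exact ⟨lam₀, lam, ⟨h₀, hρ⟩, fun j => ⟨h₁ j, hρ' j⟩, h₂⟩

theorem eventually_matrixCert {τ : Type} [Fintype τ]
    (hlim : polyhedron Cm d ⊆ jointLimitBox sl su) {M : Matrix τ τ (MvPolynomial (Fin n) ℝ)}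
    (hM : ∀ s ∈ polyhedron Cm d, ∀ u : τ → ℝ, ∑ i, u i ^ 2 = 1 →
      0 < ∑ i, ∑ j, u i * eval s (M i j) * u j) :
    ∀ᶠ ρ in atTop, MatrixCert Cm d ρ M := by
  set q : MvPolynomial (τ ⊕ Fin n) ℝ := 1 - ∑ i, X (Sum.inl i) ^ 2 with hq
  let g : Fin m ⊕ Fin 2 → MvPolynomial (τ ⊕ Fin n) ℝ :=
    -- The equation `uᵀu = 1` enters as the two inequalities `q ≥ 0` and `-q ≥ 0`. The difference of
    -- their multipliers is the free multiplier `φ`.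
    Sum.elim (fun j => rename Sum.inr (slack Cm d j)) ![q, -q]
  have hX : ∀ k, IsBoundedMod (quadraticModule g) (X k) := by
    rintro (i | k)
    · refine isBoundedMod_of_sum_sq_le (N := 1) Sum.inl ?_ i
      rw [C_1, ← hq]
      exact self_mem_quadraticModule g (Sum.inr 0)
    · rw [← rename_X (R := ℝ) (Sum.inr : Fin n → τ ⊕ Fin n)]
      exact (isBoundedMod_slack hlim k).map (rename Sum.inr) fun j =>
        self_mem_quadraticModule g (Sum.inl j)
  obtain ⟨lam₀, lam, h₀, h₁, h₂⟩ := putinar g hX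
    (f := ∑ i, ∑ j, X (Sum.inl i) * rename Sum.inr (M i j) * X (Sum.inl j)) (by
      intro y hy
      have h1 := hy (Sum.inr 0)
      have h2 := hy (Sum.inr 1)
      simp only [Sum.elim_inr, Matrix.cons_val_zero, Matrix.cons_val_one, map_neg, map_sub, map_one,
        map_sum, map_pow, eval_X, g, q] at h1 h2
      have h3 := hM (y ∘ Sum.inr)
        (mem_polyhedron_iff.2 fun j => by simpa [g, eval_rename] using hy (Sum.inl j))
        (y ∘ Sum.inl) (by simp only [Function.comp_apply]; linarith)
      simpa [eval_rename] using h3)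
  filter_upwards [eventually_ge_atTop lam₀.totalDegree,
    eventually_all.2 fun j => eventually_ge_atTop (lam (Sum.inl j)).totalDegree,
    eventually_ge_atTop (lam (Sum.inr 0) - lam (Sum.inr 1)).totalDegree] with ρ hρ hρ' hρφ
  refine ⟨lam₀, fun j => lam (Sum.inl j), lam (Sum.inr 0) - lam (Sum.inr 1), ⟨h₀, hρ⟩,
    fun j => ⟨h₁ _, hρ' j⟩, hρφ, ?_⟩
  rw [h₂, Fintype.sum_sum_type, Fin.sum_univ_two]
  simp only [Sum.elim_inl, Sum.elim_inr, Matrix.cons_val_zero, Matrix.cons_val_one, g, ← hq]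
  ring

theorem quadForm_schurMatrix {k : ℕ} (γ : MvPolynomial (Fin n) ℝ)
    (w : Fin k → MvPolynomial (Fin n) ℝ) (s : Fin n → ℝ) (u : Fin k ⊕ Unit → ℝ) :
    ∑ i, ∑ j, u i * eval s (schurMatrix γ w i j) * u j =
      eval s γ * ∑ i, u i ^ 2 +
        2 * u (Sum.inr ()) * ∑ i, eval s (w i) * u (Sum.inl i) := by
  have h1 : ∀ i : Fin k, ∑ j : Fin k, u (Sum.inl i) *
      eval s (Matrix.diagonal (fun _ => γ) i j) * u (Sum.inl j) =
        eval s γ * u (Sum.inl i) ^ 2 := by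
    intro i
    rw [Finset.sum_eq_single i]
    · rw [Matrix.diagonal_apply_eq]; ring
    · intro j _ hj
      rw [Matrix.diagonal_apply_ne _ hj.symm]; simp
    · simp
  simp only [schurMatrix, Fintype.sum_sum_type, Matrix.fromBlocks_apply₁₁,
    Matrix.fromBlocks_apply₁₂, Matrix.fromBlocks_apply₂₁, Matrix.fromBlocks_apply₂₂,
    Matrix.of_apply, h1, Finset.univ_unique, Finset.sum_singleton, Finset.sum_add_distrib]
  rw [mul_add, Finset.mul_sum]
  have h2 : ∑ x, u (Sum.inl x) * eval s (w x) * u (Sum.inr ()) =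
      u (Sum.inr ()) * ∑ x, eval s (w x) * u (Sum.inl x) := by
    rw [Finset.mul_sum]
    exact Finset.sum_congr rfl fun _ _ => by ring
  have h3 : ∑ x, u (Sum.inr ()) * eval s (w x) * u (Sum.inl x) =
      u (Sum.inr ()) * ∑ x, eval s (w x) * u (Sum.inl x) := by
    rw [Finset.mul_sum]
    exact Finset.sum_congr rfl fun _ _ => by ring
  change _ + ∑ x, u (Sum.inr ()) * eval s (w x) * u (Sum.inl x) +
    (∑ x, u (Sum.inl x) * eval s (w x) * u (Sum.inr ()) + u (Sum.inr ()) * eval s γ * u (Sum.inr ())) = _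
  rw [h2, h3]
  simp only [PUnit.default_eq_unit]
  ring

/-- For a unit vector `u = (t v, l)` with `|v| = 1` and `y = wᵀv`, the quadratic form is `γ + 2lty =
((t + l)²(γ + y) + (t - l)²(γ - y)) / 2`, where the two squares cannot both vanish. Positivity of
`γ` itself covers `t = 0`, where `v` is undefined. -/
theorem eventually_matrixCert_schurMatrix {k : ℕ}
    (hlim : polyhedron Cm d ⊆ jointLimitBox sl su) {γ : MvPolynomial (Fin n) ℝ}
    {w : Fin k → MvPolynomial (Fin n) ℝ} (hγ : ∀ s ∈ polyhedron Cm d, 0 < eval s γ)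
    (hw : ∀ s ∈ polyhedron Cm d, ∀ v : Fin k → ℝ, ∑ i, v i ^ 2 = 1 →
      0 < eval s γ + ∑ i, eval s (w i) * v i) :
    ∀ᶠ ρ in atTop, MatrixCert Cm d ρ (schurMatrix γ w) := by
  refine eventually_matrixCert hlim fun s hs u hu => ?_
  rw [quadForm_schurMatrix, hu, mul_one]
  rw [Fintype.sum_sum_type, Fintype.sum_unique fun x : Unit => u (Sum.inr x) ^ 2] at hu
  change _ + u (Sum.inr ()) ^ 2 = 1 at hu
  set l := u (Sum.inr ())
  set S := ∑ i, u (Sum.inl i) ^ 2 with hS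
  have hS0 : 0 ≤ S := Finset.sum_nonneg fun _ _ => sq_nonneg _
  rcases hS0.eq_or_lt with h0 | hpos
  · have hz : ∀ i, u (Sum.inl i) = 0 := fun i =>
      pow_eq_zero_iff two_ne_zero |>.1
        ((Finset.sum_eq_zero_iff_of_nonneg fun _ _ => sq_nonneg _).1 (hS.symm.trans h0.symm) i
          (Finset.mem_univ i))
    simpa [hz] using hγ s hs
  · set t := Real.sqrt S with ht
    have htS : t ^ 2 = S := Real.sq_sqrt hS0
    have htpos : 0 < t := Real.sqrt_pos.2 hpos
    have hunit : ∑ i, (u (Sum.inl i) / t) ^ 2 = 1 := by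
      simp only [div_pow]
      rw [← Finset.sum_div, ← hS, htS, div_self hpos.ne']
    have h1 := hw s hs (fun i => u (Sum.inl i) / t) hunit
    have h2 := hw s hs (fun i => -(u (Sum.inl i) / t)) (by simpa using hunit)
    simp only [mul_neg, Finset.sum_neg_distrib] at h2
    set y := ∑ i, eval s (w i) * (u (Sum.inl i) / t) with hy
    have hty : ∑ i, eval s (w i) * u (Sum.inl i) = t * y := by
      rw [hy, Finset.mul_sum]
      refine Finset.sum_congr rfl fun i _ => ?_
      field_simp
    rw [hty]
    have hl1 : 0 ≤ (t + l) ^ 2 := sq_nonneg _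
    have hl2 : 0 ≤ (t - l) ^ 2 := sq_nonneg _
    have h3 : eval s γ + 2 * l * (t * y) =
        ((t + l) ^ 2 * (eval s γ + y) + (t - l) ^ 2 * (eval s γ + -y)) / 2 := by
      linear_combination (-(eval s γ)) * (htS + hu)
    have h4 : 0 < (t + l) ^ 2 ∨ 0 < (t - l) ^ 2 := by
      by_contra! hcon
      nlinarith
    rw [h3]
    rcases h4 with h4 | h4
    · have := mul_pos h4 h1
      have := mul_nonneg hl2 h2.le
      linarith
    · have := mul_pos h4 h2
      have := mul_nonneg hl1 h1.le
      linarith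

theorem eventually_semialgebraicCert (hlim : polyhedron Cm d ⊆ jointLimitBox sl su)
    {a : Fin 3 → MvPolynomial (Fin n) ℝ} {b : MvPolynomial (Fin n) ℝ} {G : RatPose n} {l : ℕ}
    {γ : Fin l → MvPolynomial (Fin 3) ℝ} (harch : IsArchimedean γ)
    (h : ∀ s ∈ polyhedron Cm d, ∀ x : Fin 3 → ℝ, (∀ i, 0 ≤ eval x (γ i)) →
      0 < ∑ k, eval s (normalNum G a k) * x k + eval s (offsetNum G a (b - 1))) :
    ∀ᶠ ρ in atTop, SemialgebraicCert Cm d ρ a b G γ := by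
  let g : Fin m ⊕ Fin l → MvPolynomial (Fin 3 ⊕ Fin n) ℝ :=
    Sum.elim (fun j => rename Sum.inr (slack Cm d j)) fun i => rename Sum.inl (γ i)
  have hX : ∀ k, IsBoundedMod (quadraticModule g) (X k) := by
    rintro (k | k)
    · rw [← rename_X (R := ℝ) (Sum.inl : Fin 3 → Fin 3 ⊕ Fin n)]
      exact (harch.isBoundedMod k).map (rename Sum.inl) fun j =>
        self_mem_quadraticModule g (Sum.inr j)
    · rw [← rename_X (R := ℝ) (Sum.inr : Fin n → Fin 3 ⊕ Fin n)]
      exact (isBoundedMod_slack hlim k).map (rename Sum.inr) fun j =>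
        self_mem_quadraticModule g (Sum.inl j)
  obtain ⟨lam₀, lam, h₀, h₁, h₂⟩ := putinar g hX
    (f := ∑ k, rename Sum.inr (normalNum G a k) * X (Sum.inl k) +
        rename Sum.inr (offsetNum G a (b - 1))) (by
      intro y hy
      have h3 := h (y ∘ Sum.inr)
        (mem_polyhedron_iff.2 fun j => by simpa [g, eval_rename] using hy (Sum.inl j))
        (y ∘ Sum.inl) fun i => by simpa [g, eval_rename] using hy (Sum.inr i)
      simpa only [map_add, map_sum, map_mul, eval_rename, eval_X, Function.comp_apply] using h3)
  filter_upwards [eventually_ge_atTop lam₀.totalDegree,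
    eventually_all.2 fun j => eventually_ge_atTop (lam j).totalDegree] with ρ hρ hρ'
  refine ⟨lam₀, fun j => lam (Sum.inl j), fun i => lam (Sum.inr i), ⟨h₀, hρ⟩,
    fun j => ⟨h₁ _, hρ' _⟩, fun i => ⟨h₁ _, hρ' _⟩, ?_⟩
  rw [h₂, Fintype.sum_sum_type, add_assoc]
  rfl

/-- The value at `x` of the affine function with coefficient polynomials `a`, `b`. -/
noncomputable def planeValue (a : Fin 3 → MvPolynomial (Fin n) ℝ) (b : MvPolynomial (Fin n) ℝ)
    (s : Fin n → ℝ) (x : EuclideanSpace ℝ (Fin 3)) : ℝ :=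
  ∑ k, eval s (a k) * x k + eval s b

theorem planeValue_pos (a : Fin 3 → MvPolynomial (Fin n) ℝ) (b : MvPolynomial (Fin n) ℝ)
    (p : RatPoint n) (s : Fin n → ℝ) :
    planeValue a b s (p.pos s) * eval s p.den =
      ∑ k, eval s (a k) * eval s (p.num k) + eval s b * eval s p.den := by
  rw [planeValue, add_mul, Finset.sum_mul]
  congr 1
  refine Finset.sum_congr rfl fun k _ => ?_
  have := (p.den_pos s).ne'
  simp only [RatPoint.pos]
  field_simp

theorem planeValue_pose_point (a : Fin 3 → MvPolynomial (Fin n) ℝ) (b : MvPolynomial (Fin n) ℝ)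
    (G : RatPose n) (v : Fin 3 → ℝ) (s : Fin n → ℝ) :
    planeValue a b s ((G.point v).pos s) * eval s G.den =
      ∑ k, eval s (normalNum G a k) * v k + eval s (offsetNum G a b) := by
  refine (planeValue_pos a b (G.point v) s).trans ?_
  simp only [RatPose.point, normalNum, offsetNum, Fin.sum_univ_three, map_add, map_mul, eval_C]
  ring

theorem eval_offsetNum_sub_one (a : Fin 3 → MvPolynomial (Fin n) ℝ) (b : MvPolynomial (Fin n) ℝ)
    (G : RatPose n) (s : Fin n → ℝ) :
    eval s (offsetNum G a (b - 1)) = eval s (offsetNum G a b) - eval s G.den := by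
  simp only [offsetNum, map_add, map_mul, map_sub, map_one]
  ring

theorem eventually_pointCert (hlim : polyhedron Cm d ⊆ jointLimitBox sl su)
    {a : Fin 3 → MvPolynomial (Fin n) ℝ} {b : MvPolynomial (Fin n) ℝ} {p : RatPoint n}
    (h : ∀ s ∈ polyhedron Cm d, 1 < planeValue a b s (p.pos s)) :
    ∀ᶠ ρ in atTop, PointCert Cm d ρ a b p := by
  refine eventually_scalarCert hlim fun s hs => ?_
  have h1 := planeValue_pos a b p s
  have h2 := mul_lt_mul_of_pos_right (h s hs) (p.den_pos s)
  simp only [map_add, map_sum, map_mul, map_sub, map_one]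
  linarith

/-- The inequality `γ + wᵀv > 0` for a unit vector `v` is the plane inequality at the boundary point
`o + r v`, multiplied by the positive denominator. -/
theorem eventually_roundCert (hlim : polyhedron Cm d ⊆ jointLimitBox sl su)
    {a : Fin 3 → MvPolynomial (Fin n) ℝ} {b : MvPolynomial (Fin n) ℝ} {o : RatPoint n}
    {r : ℝ} (hr : 0 ≤ r)
    (h : ∀ s ∈ polyhedron Cm d, ∀ x ∈ Metric.closedBall (o.pos s) r, 1 < planeValue a b s x) :
    ∀ᶠ ρ in atTop, RoundCert Cm d ρ a b o r := by
  refine eventually_matrixCert_schurMatrix hlim (fun s hs => ?_) fun s hs v hv => ?_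
  · have h1 := planeValue_pos a b o s
    have h2 := mul_lt_mul_of_pos_right (h s hs _ (Metric.mem_closedBall_self hr)) (o.den_pos s)
    have h3 := o.den_pos s
    simp only [map_add, map_sum, map_mul]
    linarith
  · have hmem : o.pos s + r • WithLp.toLp 2 v ∈ Metric.closedBall (o.pos s) r := by
      rw [mem_closedBall_iff_norm, add_sub_cancel_left, norm_smul, EuclideanSpace.norm_eq]
      simp [hv, abs_of_nonneg hr]
    have h1 := planeValue_pos a b o s
    have h3 := o.den_pos s
    have h2 := mul_lt_mul_of_pos_right (h s hs _ hmem) h3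
    have h4 : planeValue a b s (o.pos s + r • WithLp.toLp 2 v) =
        planeValue a b s (o.pos s) + r * ∑ k, eval s (a k) * v k := by
      simp only [planeValue, Fin.sum_univ_three, PiLp.add_apply, PiLp.smul_apply, smul_eq_mul]
      ring
    rw [h4, add_mul, h1] at h2
    simp only [map_add, map_sum, map_mul, eval_C]
    have h5 : ∑ i, r * eval s (a i) * eval s o.den * v i =
        r * (∑ k, eval s (a k) * v k) * eval s o.den := by
      rw [Finset.mul_sum, Finset.sum_mul]
      exact Finset.sum_congr rfl fun _ _ => by ring
    rw [h5]
    linarith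

theorem eventually_rimCert (hlim : polyhedron Cm d ⊆ jointLimitBox sl su)
    {a : Fin 3 → MvPolynomial (Fin n) ℝ} {b : MvPolynomial (Fin n) ℝ} {G : RatPose n} {z r : ℝ}
    (h : ∀ s ∈ polyhedron Cm d, ∀ α : ℝ,
      1 < planeValue a b s ((G.point ![r * Real.cos α, r * Real.sin α, z]).pos s)) :
    ∀ᶠ ρ in atTop, RimCert Cm d ρ a b G z r := by
  have key : ∀ s ∈ polyhedron Cm d, ∀ α : ℝ, 0 < z * eval s (normalNum G a 2) +
      eval s (offsetNum G a b) + (r * eval s (normalNum G a 0) * Real.cos α +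
        r * eval s (normalNum G a 1) * Real.sin α) := by
    intro s hs α
    have h1 := planeValue_pose_point a b G ![r * Real.cos α, r * Real.sin α, z] s
    have h2 := mul_lt_mul_of_pos_right (h s hs α) (G.den_pos s)
    rw [h1, Fin.sum_univ_three] at h2
    simp only [Matrix.cons_val_zero, Matrix.cons_val_one, Matrix.cons_val] at h2
    have h3 := G.den_pos s
    linarith
  refine eventually_matrixCert_schurMatrix hlim (fun s hs => ?_) fun s hs v hv => ?_
  -- Averaging two antipodal rim points gives the value at the center of the circle.
  · have h1 := key s hs 0
    have h2 := key s hs Real.pi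
    simp only [Real.cos_zero, Real.sin_zero, Real.cos_pi, Real.sin_pi] at h1 h2
    simp only [map_add, map_mul, eval_C]
    linarith
  · rw [Fin.sum_univ_two] at hv
    -- Read as a complex number, the unit vector `v` has an argument, which is the angle of the rim
    -- point to test.
    have hnorm : ‖(⟨v 0, v 1⟩ : ℂ)‖ = 1 := by
      rw [Complex.norm_def, Complex.normSq_mk, ← sq, ← sq, hv, Real.sqrt_one]
    have h1 := key s hs (Complex.arg ⟨v 0, v 1⟩)
    have hc := Complex.norm_mul_cos_arg ⟨v 0, v 1⟩
    have hs := Complex.norm_mul_sin_arg ⟨v 0, v 1⟩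
    rw [hnorm, one_mul] at hc hs
    rw [hc, hs] at h1
    simpa [Fin.sum_univ_two] using h1


/-- A plane that stays at distance from a body over a bounded polyhedron admits the
certificates for that body. -/
theorem Body.eventually_sideCert (hlim : polyhedron Cm d ⊆ jointLimitBox sl su)
    {a : Fin 3 → MvPolynomial (Fin n) ℝ} {b : MvPolynomial (Fin n) ℝ} (K : Body n)
    (h : ∀ s ∈ polyhedron Cm d, ∀ x ∈ K.region s, 1 < planeValue a b s x) :
    ∀ᶠ ρ in atTop, K.SideCert Cm d ρ a b := by
  cases K with
  | polytope k v =>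
    exact eventually_all.2 fun i => eventually_pointCert hlim fun s hs =>
      h s hs _ (subset_convexHull ℝ _ ⟨i, rfl⟩)
  | sphere o r hr =>
    exact (eventually_roundCert hlim hr h).and
      (eventually_pointCert hlim fun s hs => h s hs _ (Metric.mem_closedBall_self hr))
  | capsule o₁ o₂ r₁ r₂ hr₁ hr₂ =>
    have h₁ : ∀ s ∈ polyhedron Cm d, ∀ x ∈ Metric.closedBall (o₁.pos s) r₁,
        1 < planeValue a b s x := fun s hs x hx => h s hs x (subset_convexHull ℝ _ (Or.inl hx))
    have h₂ : ∀ s ∈ polyhedron Cm d, ∀ x ∈ Metric.closedBall (o₂.pos s) r₂,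
        1 < planeValue a b s x := fun s hs x hx => h s hs x (subset_convexHull ℝ _ (Or.inr hx))
    exact ((eventually_roundCert hlim hr₁ h₁).and
      (eventually_pointCert hlim fun s hs => h₁ s hs _ (Metric.mem_closedBall_self hr₁))).and
      ((eventually_roundCert hlim hr₂ h₂).and
      (eventually_pointCert hlim fun s hs => h₂ s hs _ (Metric.mem_closedBall_self hr₂)))
  | cylinder G z r₁ r₂ hz hr₁ hr₂ =>
    have h₁ : ∀ s ∈ polyhedron Cm d, ∀ α : ℝ,
        1 < planeValue a b s ((G.point ![r₁ * Real.cos α, r₁ * Real.sin α, z]).pos s) :=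
      fun s hs α => h s hs _ (subset_convexHull ℝ _ (Or.inl ⟨α, rfl⟩))
    have h₂ : ∀ s ∈ polyhedron Cm d, ∀ α : ℝ,
        1 < planeValue a b s ((G.point ![r₂ * Real.cos α, r₂ * Real.sin α, -z]).pos s) :=
      fun s hs α => h s hs _ (subset_convexHull ℝ _ (Or.inr ⟨α, rfl⟩))
    refine (eventually_rimCert hlim h₁).and ((eventually_rimCert hlim h₂).and
      (eventually_scalarCert hlim fun s hs => ?_))
    have hd := G.den_pos s
    -- The frame origin is the average of two antipodal points on each rim, so it inherits the
    -- margin.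
    have e := fun (r z α : ℝ) => planeValue_pose_point a b G ![r * Real.cos α, r * Real.sin α, z] s
    simp only [Fin.sum_univ_three, Matrix.cons_val_zero, Matrix.cons_val_one, Matrix.cons_val] at e
    have i₁ := mul_lt_mul_of_pos_right (h₁ s hs 0) hd
    have i₂ := mul_lt_mul_of_pos_right (h₁ s hs Real.pi) hd
    have i₃ := mul_lt_mul_of_pos_right (h₂ s hs 0) hd
    have i₄ := mul_lt_mul_of_pos_right (h₂ s hs Real.pi) hd
    rw [e] at i₁ i₂ i₃ i₄
    simp only [Real.cos_zero, Real.sin_zero, Real.cos_pi, Real.sin_pi] at i₁ i₂ i₃ i₄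
    rw [eval_offsetNum_sub_one]
    linarith
  | semialgebraic G k γ hconv harch =>
    refine eventually_semialgebraicCert hlim harch fun s hs x hx => ?_
    have h1 := h s hs _ ⟨WithLp.toLp 2 x, hx, rfl⟩
    have h2 := mul_lt_mul_of_pos_right h1 (G.den_pos s)
    rw [planeValue_pose_point] at h2
    rw [eval_offsetNum_sub_one]
    linarith

end


/-! ### Bodies as convex hulls of continuous compact families -/

open MvPolynomial Filter Topology

/-- In finite dimension the convex hull of a compact set is compact. -/
theorem isCompact_convexHull {E : Type*} [AddCommGroup E] [Module ℝ E] [TopologicalSpace E]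
    [ContinuousAdd E] [ContinuousSMul ℝ E] [FiniteDimensional ℝ E] {s : Set E}
    (hs : IsCompact s) : IsCompact (convexHull ℝ s) := by
  classical
  let d := Module.finrank ℝ E + 1
  let f : (Fin d → ℝ) × (Fin d → E) → E := fun p => ∑ i, p.1 i • p.2 i
  have hf : Continuous f := by fun_prop
  -- By Carathéodory, `d = dim E + 1` points suffice. Shorter combinations are padded with zero
  -- weights on an arbitrary point of `s`.
  have himg : convexHull ℝ s = f '' (stdSimplex ℝ (Fin d) ×ˢ Set.univ.pi fun _ => s) := by
    refine Set.Subset.antisymm (fun x hx => ?_) ?_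
    · obtain ⟨ι, _, z, w, hz, hind, hw, hw1, rfl⟩ := eq_pos_convex_span_of_mem_convexHull hx
      have hcard : Fintype.card ι ≤ Fintype.card (Fin d) := by
        rw [Fintype.card_fin]
        exact hind.card_le_finrank_succ.trans (Nat.succ_le_succ (Submodule.finrank_le _))
      obtain ⟨e⟩ := Function.Embedding.nonempty_of_card_le hcard
      obtain ⟨i₀⟩ : Nonempty ι := by
        by_contra hcon
        rw [not_nonempty_iff] at hcon
        simp at hw1
      let w' : Fin d → ℝ := fun j => ∑ i with e i = j, w i
      let z' : Fin d → E := Function.extend e z fun _ => z i₀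
      have hz' : ∀ i, z' (e i) = z i := fun i => e.injective.extend_apply _ _ _
      refine ⟨(w', z'), ⟨⟨fun j => Finset.sum_nonneg fun i _ => (hw i).le, ?_⟩, fun j _ => ?_⟩, ?_⟩
      · exact (Finset.sum_fiberwise _ _ _).trans hw1
      · by_cases hj : ∃ i, e i = j
        · obtain ⟨i, rfl⟩ := hj
          change z' (e i) ∈ s
          rw [hz']
          exact hz ⟨i, rfl⟩
        · change z' j ∈ s
          rw [show z' j = z i₀ from Function.extend_apply' _ _ _ hj]
          exact hz ⟨i₀, rfl⟩
      · change ∑ j, w' j • z' j = _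
        rw [← Finset.sum_fiberwise Finset.univ e fun i => w i • z i]
        refine Finset.sum_congr rfl fun j _ => ?_
        rw [Finset.sum_smul]
        refine Finset.sum_congr rfl fun i hi => ?_
        rw [← (Finset.mem_filter.1 hi).2, hz']
    · rintro _ ⟨⟨w, z⟩, ⟨hw, hz⟩, rfl⟩
      exact (convex_convexHull ℝ s).sum_mem (fun i _ => hw.1 i) hw.2 fun i _ =>
        subset_convexHull ℝ s (hz i (Set.mem_univ i))
  rw [himg]
  exact ((isCompact_stdSimplex ℝ (Fin d)).prod (isCompact_univ_pi fun _ => hs)).image hf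

/-- A family of sets that is parametrized by a compact space, continuously in the parameter of the
family. -/
def IsCompactFamily {X Y : Type*} [TopologicalSpace X] [TopologicalSpace Y] (R : X → Set Y) :
    Prop :=
  ∃ (T : Type) (_ : TopologicalSpace T) (_ : CompactSpace T) (F : X → T → Y),
    Continuous (Function.uncurry F) ∧ ∀ x, R x = Set.range (F x)

section

variable {X Y : Type*} [TopologicalSpace X] [TopologicalSpace Y]

theorem continuous_uncurry_sumElim {T₁ T₂ : Type*} [TopologicalSpace T₁] [TopologicalSpace T₂]
    {F₁ : X → T₁ → Y} {F₂ : X → T₂ → Y} (h₁ : Continuous (Function.uncurry F₁))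
    (h₂ : Continuous (Function.uncurry F₂)) :
    Continuous (Function.uncurry fun x => Sum.elim (F₁ x) (F₂ x)) := by
  have h : (Function.uncurry fun x => Sum.elim (F₁ x) (F₂ x)) =
      Sum.elim (Function.uncurry F₁) (Function.uncurry F₂) ∘
        (Homeomorph.prodSumDistrib : X × (T₁ ⊕ T₂) ≃ₜ _) := by
    funext ⟨x, t⟩
    cases t <;> rfl
  rw [h]
  exact (h₁.sumElim h₂).comp (Homeomorph.continuous _)

theorem IsCompactFamily.union {R₁ R₂ : X → Set Y} (h₁ : IsCompactFamily R₁)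
    (h₂ : IsCompactFamily R₂) : IsCompactFamily fun x => R₁ x ∪ R₂ x := by
  obtain ⟨T₁, _, _, F₁, hF₁, hR₁⟩ := h₁
  obtain ⟨T₂, _, _, F₂, hF₂, hR₂⟩ := h₂
  refine ⟨T₁ ⊕ T₂, inferInstance, inferInstance, _, continuous_uncurry_sumElim hF₁ hF₂,
    fun x => ?_⟩
  rw [Set.Sum.elim_range, ← hR₁, ← hR₂]

theorem IsCompactFamily.image_of_isCompact {Z : Type} [TopologicalSpace Z] {K : Set Z}
    (hK : IsCompact K) {f : X → Z → Y} (hf : Continuous (Function.uncurry f)) :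
    IsCompactFamily fun x => f x '' K := by
  refine ⟨K, inferInstance, isCompact_iff_compactSpace.1 hK, fun x z => f x z,
    hf.comp (continuous_fst.prodMk (continuous_subtype_val.comp continuous_snd)), fun x => ?_⟩
  exact Set.image_eq_range _ _

theorem IsCompactFamily.isCompact {R : X → Set Y} (h : IsCompactFamily R) (x : X) :
    IsCompact (R x) := by
  obtain ⟨T, _, _, F, hF, hR⟩ := h
  rw [hR]
  exact isCompact_range (hF.comp (Continuous.prodMk_right x))

end

section

variable {n : ℕ}

theorem RatPoint.continuous_pos (p : RatPoint n) : Continuous p.pos := by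
  refine (PiLp.continuous_toLp 2 _).comp (continuous_pi fun k => ?_)
  exact (MvPolynomial.continuous_eval _).div (MvPolynomial.continuous_eval _)
    fun s => (p.den_pos s).ne'

theorem RatPose.continuous_pos_point (G : RatPose n) :
    Continuous (Function.uncurry fun (s : Fin n → ℝ) (v : Fin 3 → ℝ) => (G.point v).pos s) := by
  refine (PiLp.continuous_toLp 2 _).comp (continuous_pi fun k => ?_)
  simp only [RatPose.point, map_add, map_sum, map_mul, eval_C]
  refine Continuous.div ?_ ((MvPolynomial.continuous_eval _).comp continuous_fst)
    fun p => (G.den_pos p.1).ne'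
  refine Continuous.add (continuous_finsetSum _ fun l _ => Continuous.mul ?_ ?_) ?_
  · exact (MvPolynomial.continuous_eval _).comp continuous_fst
  · exact (continuous_apply l).comp continuous_snd
  · exact (MvPolynomial.continuous_eval _).comp continuous_fst

theorem RatPose.pos_point_combo (G : RatPose n) (s : Fin n → ℝ) {a b : ℝ} (hab : a + b = 1)
    (x y : EuclideanSpace ℝ (Fin 3)) :
    (G.point fun k => (a • x + b • y) k).pos s =
      a • (G.point fun k => x k).pos s + b • (G.point fun k => y k).pos s := by
  ext k
  have hd := (G.den_pos s).ne'
  simp only [RatPoint.pos, RatPose.point, map_add, map_mul, eval_C, PiLp.add_apply,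
    PiLp.smul_apply, smul_eq_mul, Fin.sum_univ_three]
  field_simp
  linear_combination (-(eval s (G.posNum k))) * hab

theorem isCompactFamily_closedBall (o : RatPoint n) (r : ℝ) :
    IsCompactFamily fun s => Metric.closedBall (o.pos s) r := by
  have h := IsCompactFamily.image_of_isCompact
    (isCompact_closedBall (0 : EuclideanSpace ℝ (Fin 3)) r)
    (f := fun (s : Fin n → ℝ) x => o.pos s + x)
    ((o.continuous_pos.comp continuous_fst).add continuous_snd)
  convert h using 2 with s
  rw [Set.image_add_left]
  ext x
  simp [dist_eq_norm, sub_eq_neg_add]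

theorem isCompactFamily_circle (G : RatPose n) (r z : ℝ) :
    IsCompactFamily fun s => Set.range fun α : ℝ =>
      (G.point ![r * Real.cos α, r * Real.sin α, z]).pos s := by
  have hper : Function.Periodic (fun α : ℝ => (![r * Real.cos α, r * Real.sin α, z] : Fin 3 → ℝ))
      (2 * Real.pi) := fun α => by simp
  have hcont : Continuous fun α : ℝ => (![r * Real.cos α, r * Real.sin α, z] : Fin 3 → ℝ) := by
    fun_prop
  have h := IsCompactFamily.image_of_isCompact
    (hper.compact_of_continuous Real.two_pi_pos.ne' hcont) G.continuous_pos_point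
  convert h using 2 with s
  rw [← Set.range_comp]
  rfl

/-- Evaluating the Archimedean identity at a point of the set gives `‖x‖² ≤ N`. -/
theorem isCompact_basicSet {m : ℕ} {γ : Fin m → MvPolynomial (Fin 3) ℝ} (h : IsArchimedean γ) :
    IsCompact (basicSet γ) := by
  refine Metric.isCompact_of_isClosed_isBounded ?_ ?_
  · simp only [basicSet, Set.ofPred_forall]
    refine isClosed_iInter fun i => isClosed_le continuous_const ?_
    exact (MvPolynomial.continuous_eval _).comp (PiLp.continuous_ofLp 2 _)
  · obtain ⟨N, lam₀, lam, h₀, h₁, h₂⟩ := h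
    refine (Metric.isBounded_closedBall (x := (0 : EuclideanSpace ℝ (Fin 3)))
      (r := Real.sqrt N)).subset fun x hx => ?_
    rw [mem_closedBall_zero_iff, EuclideanSpace.norm_eq]
    refine Real.sqrt_le_sqrt ?_
    have h3 := congrArg (eval fun k => x k) h₂
    have hs : ∀ s : MvPolynomial (Fin 3) ℝ, IsSumSq s → 0 ≤ eval (fun k => x k) s := by
      intro s hs
      induction hs using IsSumSq.rec' with
      | zero => simp
      | sq_add hx _ ih =>
        obtain ⟨y, rfl⟩ := hx
        rw [map_add, map_mul]
        exact add_nonneg (mul_self_nonneg _) ih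
    have h4 : 0 ≤ eval (fun k => x k) (lam₀ + ∑ i, lam i * γ i) := by
      rw [map_add, map_sum]
      refine add_nonneg (hs _ h₀) (Finset.sum_nonneg fun i _ => ?_)
      rw [map_mul]
      exact mul_nonneg (hs _ (h₁ i)) (hx i)
    rw [← h3] at h4
    simpa using h4

theorem isCompactFamily_range {k : ℕ} (v : Fin k → RatPoint n) :
    IsCompactFamily fun s => Set.range fun i => (v i).pos s := by
  refine ⟨Fin k, inferInstance, inferInstance, fun s i => (v i).pos s, ?_, fun _ => rfl⟩
  exact continuous_prod_of_discrete_right.2 fun i => (v i).continuous_pos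

/-- Every body is the convex hull of a compact family of points. -/
theorem Body.exists_isCompactFamily (K : Body n) :
    ∃ R : (Fin n → ℝ) → Set (EuclideanSpace ℝ (Fin 3)),
      IsCompactFamily R ∧ ∀ s, K.region s = convexHull ℝ (R s) := by
  cases K with
  | polytope k v => exact ⟨_, isCompactFamily_range v, fun _ => rfl⟩
  | sphere o r hr =>
    exact ⟨_, isCompactFamily_closedBall o r, fun s => (convex_closedBall _ _).convexHull_eq.symm⟩
  | capsule o₁ o₂ r₁ r₂ hr₁ hr₂ =>
    exact ⟨_, (isCompactFamily_closedBall o₁ r₁).union (isCompactFamily_closedBall o₂ r₂),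
      fun _ => rfl⟩
  | cylinder G h r₁ r₂ hh hr₁ hr₂ =>
    exact ⟨_, (isCompactFamily_circle G r₁ h).union (isCompactFamily_circle G r₂ (-h)),
      fun _ => rfl⟩
  | semialgebraic G k γ hconv harch =>
    have himg : ∀ s, (Body.semialgebraic G k γ hconv harch).region s =
        (fun v => (G.point v).pos s) '' (WithLp.ofLp '' basicSet γ) := fun s =>
      (Set.image_image (fun v => (G.point v).pos s) WithLp.ofLp (basicSet γ)).symm
    -- Convexity of the shape is needed here: the pose acts affinely, so the moved set equals its
    -- own convex hull.
    have hc : ∀ s, Convex ℝ ((Body.semialgebraic G k γ hconv harch).region s) := by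
      rintro s _ ⟨x, hx, rfl⟩ _ ⟨y, hy, rfl⟩ a b ha hb hab
      exact ⟨a • x + b • y, hconv hx hy ha hb hab, G.pos_point_combo s hab x y⟩
    refine ⟨_, IsCompactFamily.image_of_isCompact
      ((isCompact_basicSet harch).image (PiLp.continuous_ofLp 2 _)) G.continuous_pos_point,
      fun s => ?_⟩
    rw [← himg]
    exact (hc s).convexHull_eq.symm

/-! ### Polynomial families of separating planes -/

theorem exists_polynomial_near {P : Set (Fin n → ℝ)} (hP : IsCompact P) (g : C(P, ℝ)) {ε : ℝ}
    (hε : 0 < ε) : ∃ q : MvPolynomial (Fin n) ℝ, ∀ s : P, |eval (s : Fin n → ℝ) q - g s| < ε := by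
  have : CompactSpace P := isCompact_iff_compactSpace.1 hP
  let coord : Fin n → C(P, ℝ) := fun k => 
    ⟨fun s => (s : Fin n → ℝ) k, (continuous_apply k).comp continuous_subtype_val⟩
  let φ : MvPolynomial (Fin n) ℝ →ₐ[ℝ] C(P, ℝ) := aeval coord
  have hφ : ∀ q (s : P), φ q s = eval (s : Fin n → ℝ) q := by
    intro q s
    induction q using MvPolynomial.induction_on with
    | C r => simp [φ]
    | add p q hp hq => rw [map_add, map_add, ContinuousMap.add_apply, hp, hq]
    | mul_X p k hp =>
      rw [map_mul, map_mul, ContinuousMap.mul_apply, hp]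
      simp [φ, coord]
  have hsep : φ.range.SeparatesPoints := by
    intro x y hxy
    obtain ⟨k, hk⟩ := Function.ne_iff.1 (Subtype.coe_injective.ne hxy)
    refine ⟨_, ⟨φ (X k), ⟨X k, rfl⟩, rfl⟩, ?_⟩
    simpa [hφ] using hk
  obtain ⟨⟨_, q, rfl⟩, hq⟩ :=
    ContinuousMap.exists_mem_subalgebra_near_continuousMap_of_separatesPoints φ.range hsep g ε hε
  refine ⟨q, fun s => ?_⟩
  have := (ContinuousMap.norm_coe_le_norm (φ q - g) s).trans_lt hq
  rwa [ContinuousMap.sub_apply, hφ, Real.norm_eq_abs] at this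

/-- A continuous compact family of strict homogeneous linear inequalities which is solvable at each
parameter in a compact set has a solution depending polynomially on the parameter. -/
theorem exists_polynomial_solution {ι T : Type*} [Fintype ι] [TopologicalSpace T] [CompactSpace T]
    {P : Set (Fin n → ℝ)} (hP : IsCompact P) {F : (Fin n → ℝ) → T → ι → ℝ}
    (hF : Continuous (Function.uncurry F))
    (h : ∀ s ∈ P, ∃ c : ι → ℝ, ∀ t, 0 < ∑ i, c i * F s t i) :
    ∃ p : ι → MvPolynomial (Fin n) ℝ, ∀ s ∈ P, ∀ t, 1 < ∑ i, eval s (p i) * F s t i := by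
  have : CompactSpace P := isCompact_iff_compactSpace.1 hP
  have hFi : ∀ i, Continuous fun z : P × T => F z.1 z.2 i := fun i =>
    (continuous_apply i).comp (hF.comp (by fun_prop : Continuous fun z : P × T =>
      ((z.1 : Fin n → ℝ), z.2)))
  -- Continuous selection by a partition of unity: the solution sets are convex and, `T` being
  -- compact, a solution at `s` remains one nearby.
  obtain ⟨g, hg⟩ := exists_continuous_forall_mem_convex_of_local_const
    (t := fun s : P => {c : ι → ℝ | ∀ t, 0 < ∑ i, c i * F s t i})
    (fun s c hc c' hc' a b ha hb hab t => by
      have h1 := hc t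
      have h2 := hc' t
      have h3 : ∑ i, (a • c + b • c') i * F s t i =
          a * ∑ i, c i * F s t i + b * ∑ i, c' i * F s t i := by
        simp only [Pi.add_apply, Pi.smul_apply, smul_eq_mul, add_mul, Finset.sum_add_distrib,
          Finset.mul_sum, mul_assoc]
      rw [h3]
      rcases ha.eq_or_lt with rfl | ha
      · rw [zero_add] at hab
        simpa [hab] using h2
      · have := mul_pos ha h1
        have := mul_nonneg hb h2.le
        linarith)
    (fun s => by
      obtain ⟨c, hc⟩ := h s s.2
      refine ⟨c, ?_⟩
      have hcont : Continuous fun z : P × T => ∑ i, c i * F z.1 z.2 i :=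
        continuous_finsetSum _ fun i _ => continuous_const.mul (hFi i)
      have := isCompact_univ.eventually_forall_of_forall_eventually (x₀ := s)
        (P := fun (s : P) (t : T) => 0 < ∑ i, c i * F s t i)
        fun t _ => hcont.continuousAt.eventually (lt_mem_nhds (hc t))
      exact this.mono fun s' hs' t => hs' t (Set.mem_univ t))
  have hgcont : Continuous fun z : P × T => ∑ i, g z.1 i * F z.1 z.2 i :=
    continuous_finsetSum _ fun i _ =>
      (((continuous_apply i).comp (g.continuous.comp continuous_fst)).mul (hFi i))
  obtain ⟨δ, hδ, hδg⟩ : ∃ δ > 0, ∀ z : P × T, δ ≤ ∑ i, g z.1 i * F z.1 z.2 i := by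
    rcases isEmpty_or_nonempty (P × T) with _ | _
    · exact ⟨1, one_pos, fun z => isEmptyElim z⟩
    · obtain ⟨z, -, hz⟩ := isCompact_univ.exists_isMinOn Set.univ_nonempty hgcont.continuousOn
      exact ⟨_, hg z.1 z.2, fun z' => hz (Set.mem_univ z')⟩
  obtain ⟨M, hM⟩ : ∃ M, ∀ z : P × T, ∑ i, |F z.1 z.2 i| ≤ M := by
    obtain ⟨M, hM⟩ := isCompact_univ.bddAbove_image (f := fun z : P × T => ∑ i, |F z.1 z.2 i|)
      (continuous_finsetSum _ fun i _ => (hFi i).abs).continuousOn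
    exact ⟨M, fun z => hM ⟨z, Set.mem_univ z, rfl⟩⟩
  -- With this accuracy the approximation costs at most half of the margin `δ`; the factor `4 / δ`
  -- below then lifts the remaining `δ / 2` to `2 > 1`.
  have hε : 0 < δ / (2 * (|M| + 1)) := by positivity
  choose q hq using fun i => exists_polynomial_near hP
    ((⟨fun s => g s i, (continuous_apply i).comp g.continuous⟩ : C(P, ℝ))) hε
  refine ⟨fun i => C (4 / δ) * q i, fun s hs t => ?_⟩
  have h1 := hδg (⟨s, hs⟩, t)
  have h2 := hM (⟨s, hs⟩, t)
  have h3 : |∑ i, (eval s (q i) - g ⟨s, hs⟩ i) * F s t i| ≤ δ / 2 := by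
    calc |∑ i, (eval s (q i) - g ⟨s, hs⟩ i) * F s t i|
        ≤ ∑ i, |(eval s (q i) - g ⟨s, hs⟩ i) * F s t i| := Finset.abs_sum_le_sum_abs _ _
      _ ≤ ∑ i, δ / (2 * (|M| + 1)) * |F s t i| := by
          refine Finset.sum_le_sum fun i _ => ?_
          rw [abs_mul]
          exact mul_le_mul_of_nonneg_right (hq i ⟨s, hs⟩).le (abs_nonneg _)
      _ = δ / (2 * (|M| + 1)) * ∑ i, |F s t i| := by rw [Finset.mul_sum]
      _ ≤ δ / (2 * (|M| + 1)) * (|M| + 1) := by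
          refine mul_le_mul_of_nonneg_left ?_ hε.le
          linarith [le_abs_self M]
      _ = δ / 2 := by
          have : |M| + 1 ≠ 0 := by positivity
          field_simp
  have h4 : ∑ i, (eval s (q i) - g ⟨s, hs⟩ i) * F s t i =
      ∑ i, eval s (q i) * F s t i - ∑ i, g ⟨s, hs⟩ i * F s t i := by
    simp only [sub_mul, Finset.sum_sub_distrib]
  rw [h4] at h3
  have h5 : δ / 2 ≤ ∑ i, eval s (q i) * F s t i := by
    have := neg_le_of_abs_le h3
    linarith
  simp only [map_mul, eval_C, mul_assoc]
  rw [← Finset.mul_sum]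
  calc (1 : ℝ) < 4 / δ * (δ / 2) := by field_simp; norm_num
    _ ≤ _ := mul_le_mul_of_nonneg_left h5 (by positivity)

theorem exists_separating_plane {K L : Set (EuclideanSpace ℝ (Fin 3))}
    (hK : IsCompact K) (hL : IsCompact L) (h : Disjoint (convexHull ℝ K) (convexHull ℝ L)) :
    ∃ c : Option (Fin 3) → ℝ, (∀ x ∈ K, 0 < ∑ k, c (some k) * x k + c none) ∧
      ∀ y ∈ L, ∑ k, c (some k) * y k + c none < 0 := by
  obtain ⟨f, u, v, hu, huv, hv⟩ := geometric_hahn_banach_compact_closed (convex_convexHull ℝ L)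
    (isCompact_convexHull hL) (convex_convexHull ℝ K) (isCompact_convexHull hK).isClosed h.symm
  let w := (InnerProductSpace.toDual ℝ (EuclideanSpace ℝ (Fin 3))).symm f
  have hf : ∀ x, f x = ∑ k, w k * x k := by
    intro x
    rw [← InnerProductSpace.toDual_symm_apply, PiLp.inner_apply]
    exact Finset.sum_congr rfl fun k _ => by simp [w, mul_comm]
  -- Since `f < u < v` on `L` and `v < f` on `K`, the offset `-v` is strict on both sides.
  refine ⟨fun k => k.elim (-v) fun k => w k, fun x hx => ?_, fun y hy => ?_⟩
  · have := hv x (subset_convexHull ℝ K hx)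
    rw [hf] at this
    simp only [Option.elim]
    linarith
  · have := hu y (subset_convexHull ℝ L hy)
    rw [hf] at this
    simp only [Option.elim]
    linarith

/-- Homogeneous coordinates of a point of task space. -/
def homogenize (x : EuclideanSpace ℝ (Fin 3)) (k : Option (Fin 3)) : ℝ :=
  k.elim 1 fun k => x k

theorem continuous_homogenize : Continuous homogenize := by
  refine continuous_pi fun k => ?_
  cases k with
  | none => exact continuous_const
  | some k => exact (continuous_apply k).comp (PiLp.continuous_ofLp 2 _)

theorem sum_mul_homogenize (c : Option (Fin 3) → ℝ) (x : EuclideanSpace ℝ (Fin 3)) :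
    ∑ k, c k * homogenize x k = ∑ k, c (some k) * x k + c none := by
  rw [Fintype.sum_option, add_comm]
  simp [homogenize]

/-- In homogeneous coordinates both sides form one system of strict linear inequalities in `(a, b)`,
indexed by `T₁ ⊕ T₂`, with the points of `L` negated. -/
theorem exists_separating_polynomials {P : Set (Fin n → ℝ)} (hP : IsCompact P)
    {K L : (Fin n → ℝ) → Set (EuclideanSpace ℝ (Fin 3))} (hK : IsCompactFamily K)
    (hL : IsCompactFamily L)
    (h : ∀ s ∈ P, Disjoint (convexHull ℝ (K s)) (convexHull ℝ (L s))) :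
    ∃ (a : Fin 3 → MvPolynomial (Fin n) ℝ) (b : MvPolynomial (Fin n) ℝ), ∀ s ∈ P,
      (∀ x ∈ K s, 1 < planeValue a b s x) ∧ ∀ y ∈ L s, planeValue a b s y < -1 := by
  have hsep := fun (s : Fin n → ℝ) (hs : s ∈ P) =>
    exists_separating_plane (hK.isCompact s) (hL.isCompact s) (h s hs)
  obtain ⟨T₁, _, _, F₁, hF₁, hR₁⟩ := hK
  obtain ⟨T₂, _, _, F₂, hF₂, hR₂⟩ := hL
  obtain ⟨p, hp⟩ := exists_polynomial_solution hP (T := T₁ ⊕ T₂)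
    (F := fun s => Sum.elim (fun t => homogenize (F₁ s t)) fun t => -homogenize (F₂ s t))
    (continuous_uncurry_sumElim (continuous_homogenize.comp hF₁)
      (continuous_homogenize.comp hF₂).neg)
    (fun s hs => by
      obtain ⟨c, hc₁, hc₂⟩ := hsep s hs
      refine ⟨c, ?_⟩
      rintro (t | t)
      · have := hc₁ (F₁ s t) (hR₁ s ▸ ⟨t, rfl⟩)
        rwa [Sum.elim_inl, sum_mul_homogenize]
      · have := hc₂ (F₂ s t) (hR₂ s ▸ ⟨t, rfl⟩)
        simp only [Sum.elim_inr, Pi.neg_apply, mul_neg, Finset.sum_neg_distrib]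
        rwa [sum_mul_homogenize, neg_pos])
  refine ⟨fun k => p (some k), p none, fun s hs => ⟨fun x hx => ?_, fun y hy => ?_⟩⟩
  · rw [hR₁] at hx
    obtain ⟨t, rfl⟩ := hx
    have := hp s hs (Sum.inl t)
    rwa [Sum.elim_inl, sum_mul_homogenize fun k => eval s (p k)] at this
  · rw [hR₂] at hy
    obtain ⟨t, rfl⟩ := hy
    have := hp s hs (Sum.inr t)
    simp only [Sum.elim_inr, Pi.neg_apply, mul_neg, Finset.sum_neg_distrib] at this
    rw [sum_mul_homogenize fun k => eval s (p k)] at this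
    rw [planeValue]
    linarith

theorem planeValue_combo (a : Fin 3 → MvPolynomial (Fin n) ℝ) (b : MvPolynomial (Fin n) ℝ)
    (s : Fin n → ℝ) (x y : EuclideanSpace ℝ (Fin 3)) {t u : ℝ} (htu : t + u = 1) :
    planeValue a b s (t • x + u • y) = t * planeValue a b s x + u * planeValue a b s y := by
  simp only [planeValue, Fin.sum_univ_three, PiLp.add_apply, PiLp.smul_apply, smul_eq_mul]
  linear_combination (-(eval s b)) * htu

theorem planeValue_neg (a : Fin 3 → MvPolynomial (Fin n) ℝ) (b : MvPolynomial (Fin n) ℝ)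
    (s : Fin n → ℝ) (x : EuclideanSpace ℝ (Fin 3)) :
    planeValue (-a) (-b) s x = -planeValue a b s x := by
  simp only [planeValue, Fin.sum_univ_three, Pi.neg_apply, map_neg]
  ring

theorem lt_planeValue_of_mem_convexHull {a : Fin 3 → MvPolynomial (Fin n) ℝ}
    {b : MvPolynomial (Fin n) ℝ} {s : Fin n → ℝ} {r : ℝ} {K : Set (EuclideanSpace ℝ (Fin 3))}
    (h : ∀ x ∈ K, r < planeValue a b s x) : ∀ x ∈ convexHull ℝ K, r < planeValue a b s x := by
  refine convexHull_min (t := {x | r < planeValue a b s x}) h fun x hx y hy t u ht hu htu => ?_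
  rw [Set.mem_ofPred_eq, planeValue_combo a b s x y htu]
  exact (convex_Ioi r) hx hy ht hu htu

end

end HyperplaneCert

/-! ### The main theorem -/

open HyperplaneCert

theorem theoremT {n m : ℕ} {ι : Type*} [Finite ι]
    (A B : ι → HyperplaneCert.Body n)
    (Cm : Matrix (Fin m) (Fin n) ℝ) (d : Fin m → ℝ) (sl su : Fin n → ℝ)
    (hlim : HyperplaneCert.polyhedron Cm d ⊆ HyperplaneCert.jointLimitBox sl su)
    (hfree : HyperplaneCert.polyhedron Cm d ⊆ HyperplaneCert.tcFree A B) :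
    ∃ κ₀ ρ₀ : ℕ, ∀ κ ≥ κ₀, ∀ ρ ≥ ρ₀,
      HyperplaneCert.ProgramFeasible Cm d A B κ ρ := by
  have hP : IsCompact (polyhedron Cm d) := by
    refine isCompact_Icc.of_isClosed_subset ?_ hlim
    exact isClosed_le (Continuous.matrix_mulVec continuous_const continuous_id) continuous_const
  -- Margin 1, rather than mere positivity, is what the certificates containing `b - 1` demand. The
  -- planes are fixed here, before any degree of a multiplier is considered.
  have hplane : ∀ i, ∃ (a : Fin 3 → MvPolynomial (Fin n) ℝ) (b : MvPolynomial (Fin n) ℝ),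
      ∀ s ∈ polyhedron Cm d, (∀ x ∈ (A i).region s, 1 < planeValue a b s x) ∧
        ∀ y ∈ (B i).region s, 1 < planeValue (-a) (-b) s y := by
    intro i
    obtain ⟨K, hK, hAK⟩ := (A i).exists_isCompactFamily
    obtain ⟨L, hL, hBL⟩ := (B i).exists_isCompactFamily
    obtain ⟨a, b, hab⟩ := exists_separating_polynomials hP hK hL fun s hs => by
      rw [← hAK, ← hBL]
      exact hfree hs i
    refine ⟨a, b, fun s hs => ?_⟩
    rw [hAK, hBL]
    refine ⟨lt_planeValue_of_mem_convexHull (hab s hs).1,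
      lt_planeValue_of_mem_convexHull fun y hy => ?_⟩
    rw [planeValue_neg]
    linarith [(hab s hs).2 y hy]
  choose a b hab using hplane
  have hκ : ∀ᶠ κ in Filter.atTop, ∀ i,
      (∀ k, (a i k).totalDegree ≤ κ) ∧ (b i).totalDegree ≤ κ :=
    Filter.eventually_all.2 fun i =>
      (Filter.eventually_all.2 fun k => Filter.eventually_ge_atTop _).and
        (Filter.eventually_ge_atTop _)
  have hρ : ∀ᶠ ρ in Filter.atTop, ∀ i,
      (A i).SideCert Cm d ρ (a i) (b i) ∧ (B i).SideCert Cm d ρ (-a i) (-b i) :=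
    Filter.eventually_all.2 fun i =>
      ((A i).eventually_sideCert hlim fun s hs => (hab i s hs).1).and
        ((B i).eventually_sideCert hlim fun s hs => (hab i s hs).2)
  obtain ⟨κ₀, hκ₀⟩ := Filter.eventually_atTop.1 hκ
  obtain ⟨ρ₀, hρ₀⟩ := Filter.eventually_atTop.1 hρ
  refine ⟨κ₀, ρ₀, fun κ hκ ρ hρ i => ⟨a i, b i, hκ₀ κ hκ i, fun s hs => ⟨fun x hx => ?_,
    fun y hy => ?_⟩, hρ₀ ρ hρ i⟩⟩
  · exact one_pos.trans ((hab i s hs).1 x hx)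
  · have := (hab i s hs).2 y hy
    rw [planeValue_neg, planeValue] at this
    linarith
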